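/- Let $q$ be a prime power and let $P$ be the point set of $\mathrm{PG}(2,q)$, so $|P|=q^2+q+1$. A projective plane on $P$ is identified with its set of lines, each line being a subset of $P$. Two projective planes of order $q$ on $P$ are orthogoval if every line of one meets every line of the other in at most two points; a set of projective planes of order $q$ on $P$ is mutually orthogoval if any two distinct members are orthogoval. The largest size of a set of mutually orthogoval projective planes of order $q$ on $P$ is $2$ for $q\in\{2,4,5\}$ and $4$ for $q=3$. The largest size is the same if all planes of the set are required to be copies of $\mathrm{PG}(2,q)$, that is, images of $\mathrm{PG}(2,q)$ under permutations of $P$. Moreover, let $q=3$ and $D=\{0,1,3,9\}\subset\mathbb{Z}_{13}$, and for $B\subseteq\mathbb{Z}_{13}$ write $\operatorname{dev}B=\{B+x : x\in\mathbb{Z}_{13}\}$. Then there is a bijection $\mathbb{Z}_{13}\to P$ that carries $\operatorname{dev}D$ to the set of lines of $\mathrm{PG}(2,3)$ and carries $\operatorname{dev}D$, $\operatorname{dev}(-D)$, $\operatorname{dev}(2D)$, $\operatorname{dev}(-2D)$ to four distinct, mutually orthogoval projective planes of order $3$ on $P$. -/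

import Mathlib

open scoped LinearAlgebra.Projectivization

namespace Orthogoval

/-- A plane on a point set `P` is given by its set of lines `𝓛`, each line being a set of points;
incidence between points and lines of `𝓛` is set membership. -/
instance instMembershipLines {P : Type*} (𝓛 : Set (Set P)) : Membership P 𝓛 :=
  ⟨fun ℓ p => p ∈ (ℓ : Set P)⟩

/-- `𝓛` is the set of lines of a projective plane of order `q` on the point set `P`. -/
def IsProjectivePlaneOfOrder {P : Type*} (q : ℕ) (𝓛 : Set (Set P)) : Prop :=
  ∃ _ : Configuration.ProjectivePlane P 𝓛, Configuration.ProjectivePlane.order P 𝓛 = q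

/-- Each line of one plane meets each line of the other plane in at most two points. -/
def AreOrthogoval {P : Type*} (𝓛 𝓜 : Set (Set P)) : Prop :=
  ∀ ℓ ∈ 𝓛, ∀ m ∈ 𝓜, (ℓ ∩ m).encard ≤ 2

/-- `S` is a set of mutually orthogoval projective planes of order `q` on the point set `P`. -/
structure IsMutuallyOrthogoval {P : Type*} (q : ℕ) (S : Set (Set (Set P))) : Prop where
  isProjectivePlane : ∀ 𝓛 ∈ S, IsProjectivePlaneOfOrder q 𝓛
  pairwise : S.Pairwise AreOrthogoval

/-- The image of a plane under a bijection of the point sets. -/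
def mapPlane {P Q : Type*} (e : P ≃ Q) (𝓛 : Set (Set P)) : Set (Set Q) :=
  (fun ℓ => e '' ℓ) '' 𝓛

/-- The points of `PG(2, F)`. -/
abbrev PGPoint (F : Type*) [Field F] : Type _ := ℙ F (Fin 3 → F)

/-- The lines of `PG(2, F)`: the sets `{(x : y : z) | a x + b y + c z = 0}` for
`(a, b, c) ≠ 0`. -/
def pgLines (F : Type*) [Field F] : Set (Set (PGPoint F)) :=
  Set.range fun w : PGPoint F => {v : PGPoint F | v.orthogonal w}

/-- `𝓛` is a copy of `PG(2, F)` on the point set of `PG(2, F)`. -/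
def IsCopyOfPG {F : Type*} [Field F] (𝓛 : Set (Set (PGPoint F))) : Prop :=
  ∃ e : PGPoint F ≃ PGPoint F, 𝓛 = mapPlane e (pgLines F)

/-- The sizes of the sets of mutually orthogoval projective planes of order `|F|` on the point
set of `PG(2, F)`. -/
def orthogovalSizes (F : Type*) [Field F] : Set ℕ :=
  {n | ∃ S : Set (Set (Set (PGPoint F))),
    IsMutuallyOrthogoval (Nat.card F) S ∧ S.ncard = n}

/-- The sizes of the sets of mutually orthogoval projective planes on the point set of
`PG(2, F)` all of whose members are copies of `PG(2, F)`. -/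
def desarguesianOrthogovalSizes (F : Type*) [Field F] : Set ℕ :=
  {n | ∃ S : Set (Set (Set (PGPoint F))),
    IsMutuallyOrthogoval (Nat.card F) S ∧ (∀ 𝓛 ∈ S, IsCopyOfPG 𝓛) ∧ S.ncard = n}

/-- The development `{B + x | x ∈ G}` of a subset `B` of an additive group `G`. -/
def development {G : Type*} [AddGroup G] (B : Set G) : Set (Set G) :=
  Set.range fun x : G => (fun b => b + x) '' B

/-- The multiple `c D` of the difference set `D = {0, 1, 3, 9}` in `ℤ/13ℤ`. -/
def multipleD (c : ZMod 13) : Set (ZMod 13) :=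
  (fun d => c * d) '' {0, 1, 3, 9}

/-- The developments of `D`, `-D`, `2D` and `-2D`. -/
def cyclicPlanes : Set (Set (Set (ZMod 13))) :=
  {development (multipleD 1), development (multipleD (-1)),
    development (multipleD 2), development (multipleD (-2))}

end Orthogoval

/-! A line of one plane is a set of q+1 points that meets every line of an orthogoval plane in at
most two points: an oval. In small orders an oval fixes the plane around it. Projection from a point
X off the oval pairs up the points of the oval that are collinear with X, tangents giving fixed
points, so X induces an involution of the oval (`OvalLines.exists_perm`).

For q = 2, 4 the tangents concur in a nucleus, which induces the identity, and every involution with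
exactly one fixed point arises from the intersection of two of its lines; this already accounts for
all q² points. For q = 5 the tangents at two oval points meet in a point that splits the other four
points into two pairs. The partitions of the oval into three pairs that arise so are five in number
and contain each pair exactly once; up to relabelling there is only one such family
(`OvalLines.exists_relabel`, `OvalLines.ext_five`). The ten other partitions come from points on no
tangent.

Hence, if A, B, C are mutually orthogoval, A can be written down explicitly on labels, with a line
of B as the oval; its external lines are forced by the secants and tangents. A finite search over
all completions of B then leaves no room for C (`false_of_involutions`, `noThird_eq_false`). Only
completeness of the search is needed: whatever exists is found.

For q = 3 the pencils of five planes at one point p already conflict. Two of them identify the other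
twelve points with the off-diagonal cells of a 4 × 4 square, the lines through p being rows and
columns, and a search shows that no three further pencils fit (`false_of_order_three`).

The constructions use Singer difference sets D. Multiplication by a unit c maps dev D to dev cD, so
each dev cD is a copy of PG(2, q). Since nonzero differences in D are represented once, d + d' = s
has at most one unordered solution in D, so dev D and dev(-D) are orthogoval. For q = 3 the
multipliers ±1, ±2 are checked directly. -/

namespace Orthogoval

/-! ### Finite projective planes, arcs and their tangents -/

/-- The axioms and the counts of a finite projective plane of order `q`, in terms of its set of
lines. -/
structure IsPlane {P : Type*} (q : ℕ) (L : Set (Set P)) : Prop where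
  join : ∀ x y, ∃ ℓ ∈ L, x ∈ ℓ ∧ y ∈ ℓ
  eq_of_mem : ∀ {ℓ m}, ℓ ∈ L → m ∈ L → ∀ {x y}, x ≠ y → x ∈ ℓ → y ∈ ℓ → x ∈ m → y ∈ m → ℓ = m
  meet : ∀ {ℓ m}, ℓ ∈ L → m ∈ L → ∃ x, x ∈ ℓ ∧ x ∈ m
  ncard_line : ∀ {ℓ}, ℓ ∈ L → ℓ.ncard = q + 1
  ncard_pencil : ∀ x, {ℓ | ℓ ∈ L ∧ x ∈ ℓ}.ncard = q + 1
  card_points : Nat.card P = q ^ 2 + q + 1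

theorem IsProjectivePlaneOfOrder.isPlane {P : Type*} [Finite P] {q : ℕ} {L : Set (Set P)}
    (h : IsProjectivePlaneOfOrder q L) : IsPlane q L := by
  obtain ⟨h, rfl⟩ := h
  have hpen : ∀ x : P, {ℓ | ℓ ∈ L ∧ x ∈ ℓ}.ncard = Configuration.ProjectivePlane.order P L + 1 := by
    intro x
    rw [← Configuration.ProjectivePlane.lineCount_eq (L := L) x, Configuration.lineCount,
      ← Nat.card_coe_set_eq]
    exact Nat.card_congr
      { toFun := fun l => ⟨⟨l.1, l.2.1⟩, l.2.2⟩
        invFun := fun l => ⟨l.1.1, l.1.2, l.2⟩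
        left_inv := fun _ => rfl
        right_inv := fun _ => rfl }
  have hline : ∀ {ℓ : Set P}, ℓ ∈ L →
      ℓ.ncard = Configuration.ProjectivePlane.order P L + 1 := by
    intro ℓ hℓ
    rw [← Configuration.ProjectivePlane.pointCount_eq P (⟨ℓ, hℓ⟩ : L), Configuration.pointCount,
      ← Nat.card_coe_set_eq]
    rfl
  refine ⟨fun x y => ?_, ?_, ?_, hline, hpen, ?_⟩
  · by_cases hxy : x = y
    · subst hxy
      have : {ℓ | ℓ ∈ L ∧ x ∈ ℓ}.Nonempty := by
        rw [← Set.ncard_pos, hpen]; omega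
      obtain ⟨ℓ, hℓ, hx⟩ := this
      exact ⟨ℓ, hℓ, hx, hx⟩
    · have := Configuration.HasLines.mkLine_ax (L := L) hxy
      exact ⟨_, (Configuration.HasLines.mkLine (L := L) hxy).2, this.1, this.2⟩
  · intro ℓ m hℓ hm x y hxy h1 h2 h3 h4
    have := Configuration.Nondegenerate.eq_or_eq (P := P) (L := L) (l₁ := ⟨ℓ, hℓ⟩) (l₂ := ⟨m, hm⟩)
      (p₁ := x) (p₂ := y) h1 h2 h3 h4
    simpa [hxy] using this
  · intro ℓ m hℓ hm
    by_cases hlm : ℓ = m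
    · subst hlm
      have : ℓ.Nonempty := by rw [← Set.ncard_pos, hline hℓ]; omega
      obtain ⟨x, hx⟩ := this
      exact ⟨x, hx, hx⟩
    · have hne : (⟨ℓ, hℓ⟩ : L) ≠ ⟨m, hm⟩ := by simpa using hlm
      have := Configuration.HasPoints.mkPoint_ax (P := P) (L := L) hne
      exact ⟨_, this.1, this.2⟩
  · have := Fintype.ofFinite P
    rw [Nat.card_eq_fintype_card, Configuration.ProjectivePlane.card_points P L]

/-- A set that meets each line of `L` in at most two points. -/
def IsArc {P : Type*} (L : Set (Set P)) (O : Set P) : Prop :=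
  ∀ {ℓ}, ℓ ∈ L → ∀ {x y z}, x ∈ O → x ∈ ℓ → y ∈ O → y ∈ ℓ → z ∈ O → z ∈ ℓ → x ≠ y → z = x ∨ z = y

theorem eq_or_eq_of_encard_le_two {P : Type*} {s : Set P} (h : s.encard ≤ 2) {x y z : P}
    (hx : x ∈ s) (hy : y ∈ s) (hz : z ∈ s) (hxy : x ≠ y) : z = x ∨ z = y := by
  by_contra! hne
  have h3 : ({x, y, z} : Set P).encard = 3 :=
    Set.encard_eq_three.2 ⟨x, y, z, hxy, hne.1.symm, hne.2.symm, rfl⟩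
  have : ({x, y, z} : Set P) ⊆ s := by
    rintro w (rfl | rfl | rfl) <;> assumption
  have := (Set.encard_le_encard this).trans h
  rw [h3] at this
  exact absurd this (by decide)

theorem AreOrthogoval.isArc {P : Type*} {L M : Set (Set P)} (h : AreOrthogoval L M) {m : Set P}
    (hm : m ∈ M) : IsArc L m := fun hℓ _ _ _ hx hx' hy hy' hz hz' hxy =>
  eq_or_eq_of_encard_le_two (h _ hℓ m hm) ⟨hx', hx⟩ ⟨hy', hy⟩ ⟨hz', hz⟩ hxy

theorem AreOrthogoval.symm {P : Type*} {L M : Set (Set P)} (h : AreOrthogoval L M) :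
    AreOrthogoval M L := fun m hm ℓ hℓ => by
  rw [Set.inter_comm]; exact h ℓ hℓ m hm

namespace IsPlane

variable {P : Type*} [Finite P] {q : ℕ} {L : Set (Set P)} {O : Set P}

/-- Otherwise the q+1 lines through `p` would inject into the q other points of `O`. The arc
property plays no role here. -/
theorem exists_tangent (hL : IsPlane q L) (hO : O.ncard = q + 1) {p : P} (hp : p ∈ O) :
    ∃ ℓ ∈ L, p ∈ ℓ ∧ ∀ y ∈ O, y ∈ ℓ → y = p := by
  by_contra! hcon
  have : ∀ ℓ, ∃ y, ℓ ∈ L → p ∈ ℓ → y ∈ O ∧ y ∈ ℓ ∧ y ≠ p := by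
    intro ℓ
    by_cases hℓ : ℓ ∈ L ∧ p ∈ ℓ
    · obtain ⟨y, hy⟩ := hcon ℓ hℓ.1 hℓ.2
      exact ⟨y, fun _ _ => hy⟩
    · exact ⟨p, fun h1 h2 => absurd ⟨h1, h2⟩ hℓ⟩
  choose f hf using this
  have hle := Set.ncard_le_ncard_of_injOn (s := {ℓ | ℓ ∈ L ∧ p ∈ ℓ}) (t := O \ {p}) f
    (fun ℓ hℓ => ⟨(hf ℓ hℓ.1 hℓ.2).1, (hf ℓ hℓ.1 hℓ.2).2.2⟩)
    (fun ℓ hℓ m hm hfe => by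
      have h1 := hf ℓ hℓ.1 hℓ.2
      have h2 := hf m hm.1 hm.2
      exact hL.eq_of_mem hℓ.1 hm.1 h1.2.2 h1.2.1 hℓ.2 (hfe ▸ h2.2.1) hm.2)
  rw [hL.ncard_pencil, Set.ncard_sdiff_singleton_of_mem hp, hO] at hle
  omega

/-- The q other points of an arc lie on distinct lines through `p`; two tangents would leave only
q-1 lines for them. -/
theorem tangent_unique (hL : IsPlane q L) (hq : 0 < q) (harc : IsArc L O) (hO : O.ncard = q + 1)
    {p : P} (hp : p ∈ O) {ℓ m : Set P} (hℓ : ℓ ∈ L) (hpℓ : p ∈ ℓ) (hℓO : ∀ y ∈ O, y ∈ ℓ → y = p)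
    (hm : m ∈ L) (hpm : p ∈ m) (hmO : ∀ y ∈ O, y ∈ m → y = p) : ℓ = m := by
  by_contra hne
  choose f hf using fun y => hL.join p y
  have hle := Set.ncard_le_ncard_of_injOn (s := O \ {p})
    (t := ({ℓ | ℓ ∈ L ∧ p ∈ ℓ} \ {ℓ}) \ {m}) f
    (fun y hy => ⟨⟨⟨(hf y).1, (hf y).2.1⟩, fun h => hy.2 (hℓO y hy.1 (h ▸ (hf y).2.2))⟩,
      fun h => hy.2 (hmO y hy.1 (h ▸ (hf y).2.2))⟩)
    (fun y hy z hz hfe => by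
      rcases harc (hf y).1 hp (hf y).2.1 hy.1 (hf y).2.2 hz.1 (hfe ▸ (hf z).2.2)
        (fun h => hy.2 h.symm) with h | h
      · exact absurd h hz.2
      · exact h.symm)
  rw [Set.ncard_sdiff_singleton_of_mem (show m ∈ {ℓ | ℓ ∈ L ∧ p ∈ ℓ} \ {ℓ} from
      ⟨⟨hm, hpm⟩, fun h => hne h.symm⟩),
    Set.ncard_sdiff_singleton_of_mem (show ℓ ∈ {ℓ | ℓ ∈ L ∧ p ∈ ℓ} from ⟨hℓ, hpℓ⟩),
    hL.ncard_pencil, Set.ncard_sdiff_singleton_of_mem hp, hO] at hle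
  omega

end IsPlane

/-! ### A search for planes

Sets of points are coded by the bits of natural numbers. The functions are written with recursors
because the kernel evaluates them. -/

theorem natBeq_eq_decide (a b : ℕ) : Nat.beq a b = decide (a = b) :=
  Bool.eq_iff_iff.2 (by rw [Nat.beq_eq, decide_eq_true_eq])

/-- The bit test, in a form that the kernel evaluates quickly. -/
def hasBit (m z : ℕ) : Bool := Nat.beq (Nat.land (Nat.shiftRight m z) 1) 1

theorem hasBit_eq (m z : ℕ) : hasBit m z = m.testBit z := by
  have h : hasBit m z = ((m >>> z) &&& 1).beq 1 := rfl
  rw [h, Nat.testBit_eq_decide_div_mod_eq, Nat.and_one_is_mod, Nat.shiftRight_eq_div_pow]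
  rcases Nat.mod_two_eq_zero_or_one (m / 2 ^ z) with h | h <;> simp [h, natBeq_eq_decide]

/-- `List.foldr`, defined by the recursor. -/
noncomputable def recFoldr {α β : Type} (f : α → β → β) (b : β) (l : List α) : β :=
  List.rec b (fun a _ ih => f a ih) l

/-- `List.filter`, defined by the recursor. -/
noncomputable def recFilter (p : ℕ → Bool) (l : List ℕ) : List ℕ :=
  List.rec [] (fun a _ ih => Bool.rec ih (a :: ih) (p a)) l

theorem recFilter_eq (p : ℕ → Bool) (l : List ℕ) : recFilter p l = l.filter p := by
  induction l with
  | nil => rfl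
  | cons a l ih =>
    have h : recFilter p (a :: l) = Bool.rec (recFilter p l) (a :: recFilter p l) (p a) := rfl
    rw [h, ih, List.filter_cons]
    cases p a <;> rfl

theorem mem_recFilter {p : ℕ → Bool} {l : List ℕ} {m : ℕ} :
    m ∈ recFilter p l ↔ m ∈ l ∧ p m = true := by
  rw [recFilter_eq, List.mem_filter]

/-- `List.all`, defined by the recursor. -/
noncomputable def recAll (p : ℕ → Bool) (l : List ℕ) : Bool :=
  List.rec true (fun a _ ih => Bool.rec false ih (p a)) l

theorem recAll_of_forall {p : ℕ → Bool} {l : List ℕ} (h : ∀ a ∈ l, p a = true) :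
    recAll p l = true := by
  induction l with
  | nil => rfl
  | cons a l ih =>
    have h' : recAll p (a :: l) = Bool.rec false (recAll p l) (p a) := rfl
    rw [h', h a (by simp), ih fun b hb => h b (by simp [hb])]

/-- Adds to `f` the bits of the members of the list that have a bit in common with `cur`. -/
noncomputable def updateForbidden (cur : ℕ) (l : List ℕ) : ℕ → ℕ :=
  List.rec (fun f => f)
    (fun ℓ _ ih f => Bool.rec (ih (Nat.lor f ℓ)) (ih f) (Nat.beq (Nat.land ℓ cur) 0)) l

theorem testBit_updateForbidden {cur : ℕ} {l : List ℕ} {f i : ℕ}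
    (h : (updateForbidden cur l f).testBit i) :
    f.testBit i ∨ ∃ ℓ ∈ l, ℓ.testBit i ∧ ∃ w, ℓ.testBit w ∧ cur.testBit w := by
  induction l generalizing f with
  | nil => exact Or.inl h
  | cons ℓ l ih =>
    have h' : updateForbidden cur (ℓ :: l) f =
      Bool.rec (updateForbidden cur l (f ||| ℓ)) (updateForbidden cur l f)
        (Nat.beq (ℓ &&& cur) 0) := rfl
    rw [h'] at h
    cases hb : Nat.beq (ℓ &&& cur) 0
    · rw [hb] at h
      rcases ih h with h1 | ⟨ℓ', hℓ', h1⟩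
      · rw [Nat.testBit_or, Bool.or_eq_true] at h1
        rcases h1 with h1 | h1
        · exact Or.inl h1
        · refine Or.inr ⟨ℓ, by simp, h1, ?_⟩
          have hne : ℓ &&& cur ≠ 0 := fun h0 => by simp [h0] at hb
          obtain ⟨w, hw⟩ := Nat.exists_testBit_of_ne_zero hne
          rw [Nat.testBit_and, Bool.and_eq_true] at hw
          exact ⟨w, hw⟩
      · exact Or.inr ⟨ℓ', by simp [hℓ'], h1⟩
    · rw [hb] at h
      rcases ih h with h1 | ⟨ℓ', hℓ', h1⟩
      · exact Or.inl h1
      · exact Or.inr ⟨ℓ', by simp [hℓ'], h1⟩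

/-- Extends the set `cur` by `cnt` of the points in the list. A point `(z, j, pen)` of the list,
once taken, excludes the points of `j`, and the points of each member of `pen` that already has a
point in `cur`. -/
noncomputable def extend (l : List (ℕ × ℕ × List ℕ)) : ℕ → ℕ → ℕ → List ℕ → List ℕ :=
  List.rec (fun cur _ cnt acc => Bool.rec acc (cur :: acc) (Nat.beq cnt 0))
    (fun p _ ih cur forb cnt acc =>
      Bool.rec
        (Bool.rec
          (ih (Nat.lor cur (Nat.shiftLeft 1 p.1)) (updateForbidden cur p.2.2 (Nat.lor forb p.2.1))
            (Nat.pred cnt) (ih cur forb cnt acc))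
          (ih cur forb cnt acc)
          (hasBit forb p.1))
        (cur :: acc)
        (Nat.beq cnt 0)) l

theorem extend_cons (p : ℕ × ℕ × List ℕ) (ps : List (ℕ × ℕ × List ℕ)) (cur forb cnt : ℕ)
    (acc : List ℕ) :
    extend (p :: ps) cur forb cnt acc =
      bif Nat.beq cnt 0 then cur :: acc
      else bif forb.testBit p.1 then extend ps cur forb cnt acc
      else extend ps (cur ||| 1 <<< p.1) (updateForbidden cur p.2.2 (forb ||| p.2.1)) (cnt - 1)
        (extend ps cur forb cnt acc) := by
  rw [← hasBit_eq]
  have h : extend (p :: ps) cur forb cnt acc =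
      Bool.rec
        (Bool.rec
          (extend ps (cur ||| 1 <<< p.1) (updateForbidden cur p.2.2 (forb ||| p.2.1)) (cnt - 1)
            (extend ps cur forb cnt acc))
          (extend ps cur forb cnt acc)
          (hasBit forb p.1))
        (cur :: acc)
        (Nat.beq cnt 0) := rfl
  rw [h]
  cases Nat.beq cnt 0 <;> cases hasBit forb p.1 <;> rfl

theorem mem_extend_of_mem {m : ℕ} (ps : List (ℕ × ℕ × List ℕ)) (cur forb cnt : ℕ)
    {acc : List ℕ} (h : m ∈ acc) : m ∈ extend ps cur forb cnt acc := by
  induction ps generalizing cur forb cnt acc with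
  | nil =>
    have h' : extend [] cur forb cnt acc = Bool.rec acc (cur :: acc) (Nat.beq cnt 0) := rfl
    rw [h']
    cases Nat.beq cnt 0
    · exact h
    · exact List.mem_cons_of_mem _ h
  | cons p ps ih =>
    rw [extend_cons]
    cases Nat.beq cnt 0
    · cases forb.testBit p.1
      · exact ih _ _ _ (ih _ _ _ h)
      · exact ih _ _ _ h
    · exact List.mem_cons_of_mem _ h

/-- `ℓ` and `m` have at most two bits in common. -/
def MeetAtMostTwo (ℓ m : ℕ) : Prop :=
  ∀ x y z, ℓ.testBit x → ℓ.testBit y → ℓ.testBit z → m.testBit x → m.testBit y → m.testBit z →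
    x ≠ y → x ≠ z → y ≠ z → False

/-- `ℓ` and `m` have at most one bit in common. -/
def MeetAtMostOne (ℓ m : ℕ) : Prop :=
  ∀ x y, ℓ.testBit x → ℓ.testBit y → m.testBit x → m.testBit y → x = y

/-- Completeness of the search. The invariant is that `m` consists of `cur` and of points still in
the list, none of which is forbidden. Following the decisions that agree with `m` leads to `m`; the
other branches only add to the accumulator. -/
theorem mem_extend {m : ℕ} (ps : List (ℕ × ℕ × List ℕ)) (hnd : (ps.map Prod.fst).Nodup)
    (hJ : ∀ p ∈ ps, m.testBit p.1 → ∀ z, m.testBit z → z ≠ p.1 → ¬ p.2.1.testBit z)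
    (hpen : ∀ p ∈ ps, ∀ ℓ ∈ p.2.2, ℓ.testBit p.1 ∧ MeetAtMostTwo ℓ m)
    (cur forb cnt : ℕ) (acc : List ℕ)
    (hcur : ∀ i, m.testBit i ↔ cur.testBit i ∨ i ∈ ps.map Prod.fst ∧ m.testBit i)
    (hcur' : ∀ p ∈ ps, ¬ cur.testBit p.1)
    (hforb : ∀ p ∈ ps, m.testBit p.1 → ¬ forb.testBit p.1)
    (hcnt : cnt = (ps.map Prod.fst).countP m.testBit) : m ∈ extend ps cur forb cnt acc := by
  induction ps generalizing cur forb cnt acc with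
  | nil =>
    have h' : extend [] cur forb cnt acc = Bool.rec acc (cur :: acc) (Nat.beq cnt 0) := rfl
    have : m = cur := Nat.eq_of_testBit_eq fun i => by
      have := hcur i
      simp only [List.map_nil, List.not_mem_nil, false_and, or_false] at this
      exact Bool.eq_iff_iff.2 this
    simp only [List.map_nil, List.countP_nil] at hcnt
    subst hcnt this
    rw [h']
    simp
  | cons p ps ih =>
    rw [extend_cons]
    by_cases h0 : cnt = 0
    · have : m = cur := Nat.eq_of_testBit_eq fun i => by
        have h1 := hcur i
        have h2 : ¬ (i ∈ (p :: ps).map Prod.fst ∧ m.testBit i) := by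
          rintro ⟨h3, h4⟩
          rw [h0, eq_comm, List.countP_eq_zero] at hcnt
          exact hcnt i h3 h4
        exact Bool.eq_iff_iff.2 (h1.trans (or_iff_left h2))
      subst h0 this
      simp
    · have hb : Nat.beq cnt 0 = false := by simpa [natBeq_eq_decide] using h0
      rw [hb, cond_false]
      simp only [List.map_cons, List.nodup_cons] at hnd
      simp only [List.map_cons, List.countP_cons] at hcnt
      have hskip : ¬ m.testBit p.1 → m ∈ extend ps cur forb cnt acc := by
        intro hp
        refine ih hnd.2 (fun r hr => hJ r (by simp [hr])) (fun r hr => hpen r (by simp [hr]))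
          cur forb cnt acc ?_ (fun r hr => hcur' r (by simp [hr]))
          (fun r hr => hforb r (by simp [hr])) ?_
        · intro i
          refine (hcur i).trans ?_
          rw [List.map_cons, List.mem_cons]
          refine or_congr_right (and_congr_left fun hi => or_iff_right ?_)
          rintro rfl
          exact hp hi
        · rw [hcnt, if_neg hp, add_zero]
      by_cases hp : m.testBit p.1
      · have hf : forb.testBit p.1 = false := by
          simpa using hforb p (by simp) hp
        rw [hf, cond_false]
        refine ih hnd.2 (fun r hr => hJ r (by simp [hr])) (fun r hr => hpen r (by simp [hr]))
          _ _ _ _ ?_ ?_ ?_ ?_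
        · intro i
          refine (hcur i).trans ?_
          rw [List.map_cons, List.mem_cons, Nat.testBit_or, Nat.one_shiftLeft,
            Nat.testBit_two_pow, Bool.or_eq_true, decide_eq_true_eq]
          constructor
          · rintro (h | ⟨rfl | h, hi⟩)
            · exact Or.inl (Or.inl h)
            · exact Or.inl (Or.inr rfl)
            · exact Or.inr ⟨h, hi⟩
          · rintro ((h | rfl) | ⟨h, hi⟩)
            · exact Or.inl h
            · exact Or.inr ⟨Or.inl rfl, hp⟩
            · exact Or.inr ⟨Or.inr h, hi⟩
        · intro r hr hr'
          rw [Nat.testBit_or, Nat.one_shiftLeft, Nat.testBit_two_pow, Bool.or_eq_true,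
            decide_eq_true_eq] at hr'
          rcases hr' with hr' | hr'
          · exact hcur' r (by simp [hr]) hr'
          · exact hnd.1 (hr' ▸ List.mem_map_of_mem hr)
        · intro r hr hmr hr'
          have hrp : r.1 ≠ p.1 := fun h => hnd.1 (h ▸ List.mem_map_of_mem hr)
          rcases testBit_updateForbidden hr' with h1 | ⟨ℓ, hℓ, h1, w, h2, h3⟩
          · rw [Nat.testBit_or, Bool.or_eq_true] at h1
            rcases h1 with h1 | h1
            · exact hforb r (by simp [hr]) hmr h1
            · exact hJ p (by simp) hp r.1 hmr hrp h1
          -- If a later point `r` of `m` became forbidden through `ℓ`, then `ℓ` would contain three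
          -- points of `m`: `p`, `r` and an earlier point `w`.
          · obtain ⟨h4, h5⟩ := hpen p (by simp) ℓ hℓ
            refine h5 p.1 r.1 w h4 h1 h2 hp hmr ((hcur w).2 (Or.inl h3)) hrp.symm ?_ ?_
            · rintro rfl
              exact hcur' p (by simp) h3
            · rintro rfl
              exact hcur' r (by simp [hr]) h3
        · rw [hcnt, if_pos hp, Nat.add_sub_cancel]
      · cases forb.testBit p.1
        · exact mem_extend_of_mem _ _ _ _ (hskip hp)
        · exact hskip hp

/-- The union of the members of `K` that contain `z`. -/
noncomputable def joined (z : ℕ) (K : List ℕ) : ℕ :=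
  List.rec 0 (fun ℓ _ ih => Bool.rec ih (Nat.lor ℓ ih) (hasBit ℓ z)) K

theorem testBit_joined {z : ℕ} {K : List ℕ} {i : ℕ} :
    (joined z K).testBit i ↔ ∃ ℓ ∈ K, ℓ.testBit z ∧ ℓ.testBit i := by
  induction K with
  | nil =>
    have : joined z [] = 0 := rfl
    simp [this]
  | cons ℓ K ih =>
    have h : joined z (ℓ :: K) = Bool.rec (joined z K) (ℓ ||| joined z K) (hasBit ℓ z) := rfl
    rw [h, hasBit_eq]
    cases hb : ℓ.testBit z
    · simp [ih, hb]
    · simp [ih, hb]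

/-- The sets of `k` points among `0, …, n - 1` that contain `a` and no other point of `forb`, that
meet the members of `K₁` in at most one point and those of `K₂` in at most two points. -/
noncomputable def candidates (n : ℕ) (K₁ K₂ : List ℕ) (k a forb : ℕ) : List ℕ :=
  extend (((List.range n).filter fun z => !(Nat.beq z a)).map fun z =>
    (z, joined z K₁, recFilter (fun ℓ => hasBit ℓ z) K₂)) (Nat.shiftLeft 1 a) forb (Nat.pred k) []

theorem mem_candidates {n k a forb m : ℕ} {K₁ K₂ : List ℕ} (hn : ∀ i, m.testBit i → i < n)
    (hk : (List.range n).countP m.testBit = k) (ha : m.testBit a)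
    (h1 : ∀ ℓ ∈ K₁, MeetAtMostOne ℓ m) (h2 : ∀ ℓ ∈ K₂, MeetAtMostTwo ℓ m)
    (hf : ∀ z, m.testBit z → z ≠ a → ¬ forb.testBit z) :
    m ∈ candidates n K₁ K₂ k a forb := by
  have hfst : (((List.range n).filter fun z => !(Nat.beq z a)).map fun z =>
      (z, joined z K₁, recFilter (fun ℓ => hasBit ℓ z) K₂)).map Prod.fst =
      (List.range n).filter fun z => !(Nat.beq z a) := by
    rw [List.map_map]
    exact List.map_id _
  have hne : ∀ z, z ∈ (List.range n).filter (fun z => !(Nat.beq z a)) ↔ z < n ∧ z ≠ a := by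
    intro z
    rw [List.mem_filter, List.mem_range]
    simp [natBeq_eq_decide]
  refine mem_extend _ ?_ ?_ ?_ _ _ _ _ ?_ ?_ ?_ ?_
  · rw [hfst]
    exact List.nodup_range.filter _
  · rintro _ hp hz w hw hwz
    obtain ⟨z, hz', rfl⟩ := List.mem_map.1 hp
    rw [testBit_joined]
    rintro ⟨ℓ, hℓ, h3, h4⟩
    exact hwz (h1 ℓ hℓ w z h4 h3 hw hz)
  · rintro _ hp ℓ hℓ
    obtain ⟨z, hz', rfl⟩ := List.mem_map.1 hp
    rw [mem_recFilter, hasBit_eq] at hℓ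
    exact ⟨hℓ.2, h2 ℓ hℓ.1⟩
  · intro i
    rw [hfst, hne]
    have : Nat.shiftLeft 1 a = 2 ^ a := Nat.one_shiftLeft a
    rw [this, Nat.testBit_two_pow, decide_eq_true_eq]
    constructor
    · intro hi
      by_cases hia : a = i
      · exact Or.inl hia
      · exact Or.inr ⟨⟨hn i hi, fun h => hia h.symm⟩, hi⟩
    · rintro (rfl | h)
      · exact ha
      · exact h.2
  · rintro _ hp
    obtain ⟨z, hz, rfl⟩ := List.mem_map.1 hp
    have : Nat.shiftLeft 1 a = 2 ^ a := Nat.one_shiftLeft a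
    rw [this, Nat.testBit_two_pow, decide_eq_true_eq]
    exact fun h => ((hne z).1 hz).2 h.symm
  · rintro _ hp hz
    obtain ⟨z, hz', rfl⟩ := List.mem_map.1 hp
    exact hf z hz ((hne z).1 hz').2
  -- The point `a` is taken at the outset, so `k - 1` points remain to be chosen.
  · rw [hfst, ← hk, List.countP_eq_countP_filter_add _ m.testBit fun z => !(Nat.beq z a)]
    have h3 : (List.range n).filter (fun z => !!(Nat.beq z a)) = [a] := by
      have : (fun z => !!(Nat.beq z a)) = fun z => z == a := by
        funext z
        rw [Bool.not_not, natBeq_eq_decide]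
        rfl
      rw [this, List.filter_beq, List.count_eq_one_of_mem List.nodup_range
        (List.mem_range.2 (hn a ha))]
      rfl
    rw [h3, List.countP_singleton, if_pos ha]
    rfl

/-- `t` without its lowest bit. -/
def dropBit (t : ℕ) : ℕ := Nat.land t (Nat.pred t)

theorem testBit_dropBit {t i : ℕ} (h : (dropBit t).testBit i) :
    t.testBit i ∧ ∃ j < i, t.testBit j := by
  have h' : dropBit t = t &&& (t - 1) := rfl
  rw [h', Nat.testBit_and, Bool.and_eq_true] at h
  refine ⟨h.1, ?_⟩
  by_contra! hcon
  have hmod : t % 2 ^ i = 0 := Nat.eq_of_testBit_eq fun j => by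
    rw [Nat.testBit_mod_two_pow, Nat.zero_testBit]
    by_cases hj : j < i
    · simp [hcon j hj]
    · simp [hj]
  -- If `i` is the lowest bit, then `t = 2 ^ i * u` with `u` odd, and bit `i` of `t - 1` is the
  -- lowest bit of `u - 1`, which is zero.
  obtain ⟨u, rfl⟩ := Nat.dvd_of_mod_eq_zero hmod
  have hpos : 0 < 2 ^ i := by positivity
  rw [Nat.testBit_eq_decide_div_mod_eq, Nat.testBit_eq_decide_div_mod_eq, decide_eq_true_eq,
    decide_eq_true_eq, Nat.mul_div_cancel_left _ hpos] at h
  obtain ⟨v, rfl⟩ : ∃ v, u = v + 1 := ⟨u - 1, by omega⟩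
  have h3 : 2 ^ i * (v + 1) - 1 = 2 ^ i * v + (2 ^ i - 1) := by
    rw [mul_add, mul_one]; omega
  rw [h3, Nat.mul_add_div hpos, Nat.div_eq_of_lt (by omega : 2 ^ i - 1 < 2 ^ i)] at h
  omega

/-- Tests whether two numbers have at most one common bit. -/
def meetsOne (b c : ℕ) : Bool := Nat.beq (dropBit (Nat.land b c)) 0

/-- Tests whether two numbers have at most two common bits. -/
def meetsTwo (b c : ℕ) : Bool := Nat.beq (dropBit (dropBit (Nat.land b c))) 0

theorem meetsOne_of {b c : ℕ} (h : MeetAtMostOne b c) : meetsOne b c = true := by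
  by_contra hcon
  have h0 : dropBit (b &&& c) ≠ 0 := fun h0 => hcon (by
    have : meetsOne b c = Nat.beq (dropBit (b &&& c)) 0 := rfl
    rw [this, h0]; rfl)
  obtain ⟨i, hi⟩ := Nat.exists_testBit_of_ne_zero h0
  obtain ⟨h1, j, hj, h2⟩ := testBit_dropBit hi
  rw [Nat.testBit_and, Bool.and_eq_true] at h1 h2
  exact hj.ne' (h i j h1.1 h2.1 h1.2 h2.2)

theorem meetsTwo_of {b c : ℕ} (h : MeetAtMostTwo b c) : meetsTwo b c = true := by
  by_contra hcon
  have h0 : dropBit (dropBit (b &&& c)) ≠ 0 := fun h0 => hcon (by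
    have : meetsTwo b c = Nat.beq (dropBit (dropBit (b &&& c))) 0 := rfl
    rw [this, h0]; rfl)
  obtain ⟨i, hi⟩ := Nat.exists_testBit_of_ne_zero h0
  obtain ⟨h1, j, hj, h2⟩ := testBit_dropBit hi
  obtain ⟨h2, l, hl, h3⟩ := testBit_dropBit h2
  replace h1 := (testBit_dropBit h1).1
  rw [Nat.testBit_and, Bool.and_eq_true] at h1 h2 h3
  exact h i j l h1.1 h2.1 h3.1 h1.2 h2.2 h3.2 hj.ne' (hl.trans hj).ne' hl.ne'

/-! ### Completing pencils of lines -/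

/-- Adds to the list `ch` lines through `a`, taken from `cs`, which cover the points in the list
`ys`, in all possible ways; the points of `u` are already covered. -/
noncomputable def cover (a : ℕ) (ys : List ℕ) :
    List ℕ → List ℕ → ℕ → List (List ℕ) → List (List ℕ) :=
  List.rec (fun _ ch _ acc => ch :: acc)
    (fun y _ ih cs ch u acc => Bool.rec
      (recFoldr (fun c jh =>
        ih (recFilter (fun d => Nat.beq (Nat.land c d) (Nat.shiftLeft 1 a)) cs) (c :: ch)
          (Nat.lor u c) jh) acc (recFilter (fun c => hasBit c y) cs))
      (ih cs ch u acc) (hasBit u y)) ys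

/-- Some member of the list consists of elements of `Q` only. -/
def SomeIn (Q : Set ℕ) (Bs : List (List ℕ)) : Prop := ∃ B ∈ Bs, ∀ m ∈ B, m ∈ Q

theorem someIn_recFoldr_of_someIn {α : Type} {Q : Set ℕ}
    {g : α → List (List ℕ) → List (List ℕ)} (hg : ∀ c acc, SomeIn Q acc → SomeIn Q (g c acc))
    {l : List α} {acc : List (List ℕ)} (h : SomeIn Q acc) : SomeIn Q (recFoldr g acc l) := by
  induction l with
  | nil => exact h
  | cons c l ih => exact hg c _ ih

theorem someIn_recFoldr {α : Type} {Q : Set ℕ} {g : α → List (List ℕ) → List (List ℕ)}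
    (hg : ∀ c acc, SomeIn Q acc → SomeIn Q (g c acc)) {l : List α} {acc : List (List ℕ)} {c : α}
    (hc : c ∈ l) (h : ∀ acc, SomeIn Q (g c acc)) : SomeIn Q (recFoldr g acc l) := by
  induction l with
  | nil => simp at hc
  | cons d l ih =>
    rcases List.mem_cons.1 hc with rfl | hc
    · exact h _
    · exact hg d _ (ih hc)

theorem someIn_cover_of_someIn {Q : Set ℕ} {a : ℕ} (ys cs ch : List ℕ) (u : ℕ)
    {acc : List (List ℕ)} (h : SomeIn Q acc) : SomeIn Q (cover a ys cs ch u acc) := by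
  induction ys generalizing cs ch u acc with
  | nil =>
    obtain ⟨B, hB, h⟩ := h
    exact ⟨B, List.mem_cons_of_mem _ hB, h⟩
  | cons y ys ih =>
    have h' : cover a (y :: ys) cs ch u acc = Bool.rec
      (recFoldr (fun c jh =>
        cover a ys (recFilter (fun d => Nat.beq (c &&& d) (Nat.shiftLeft 1 a)) cs) (c :: ch)
          (u ||| c) jh) acc (recFilter (fun c => hasBit c y) cs))
      (cover a ys cs ch u acc) (hasBit u y) := rfl
    rw [h']
    cases hasBit u y
    · exact someIn_recFoldr_of_someIn (fun c acc hacc => ih _ _ _ hacc) h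
    · exact ih _ _ _ h

/-- At each uncovered point `y` one branch picks the line of `M` that joins `a` and `y`. Discarding
the candidates that meet it outside `a` loses no other line of `M`, and the line itself is covered
from then on; these are the two alternatives in the last hypothesis. The order of `ys` is irrelevant
to correctness. -/
theorem someIn_cover {M Q : Set ℕ} (hMQ : M ⊆ Q) {a : ℕ} (ys cs ch : List ℕ) (u : ℕ)
    (acc : List (List ℕ)) (hjoin : ∀ y ∈ ys, ∃ m ∈ M, m.testBit a ∧ m.testBit y)
    (hmeet : ∀ c ∈ M, ∀ d ∈ M, c.testBit a → d.testBit a → c ≠ d → MeetAtMostOne c d)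
    (hch : ∀ m ∈ ch, m ∈ Q)
    (hcs : ∀ m ∈ M, m.testBit a → (∃ y ∈ ys, m.testBit y) →
      m ∈ cs ∨ ∀ i, m.testBit i → u.testBit i) : SomeIn Q (cover a ys cs ch u acc) := by
  induction ys generalizing cs ch u acc with
  | nil => exact ⟨ch, List.mem_cons_self, hch⟩
  | cons y ys ih =>
    have h' : cover a (y :: ys) cs ch u acc = Bool.rec
      (recFoldr (fun c jh =>
        cover a ys (recFilter (fun d => Nat.beq (c &&& d) (Nat.shiftLeft 1 a)) cs) (c :: ch)
          (u ||| c) jh) acc (recFilter (fun c => hasBit c y) cs))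
      (cover a ys cs ch u acc) (hasBit u y) := rfl
    have hjoin' : ∀ y ∈ ys, ∃ m ∈ M, m.testBit a ∧ m.testBit y :=
      fun z hz => hjoin z (List.mem_cons_of_mem _ hz)
    rw [h']
    cases hu : hasBit u y
    · obtain ⟨c, hcM, hca, hcy⟩ := hjoin y (by simp)
      have hc : c ∈ recFilter (fun c => hasBit c y) cs := by
        rw [mem_recFilter, hasBit_eq]
        refine ⟨(hcs c hcM hca ⟨y, by simp, hcy⟩).resolve_right fun h => ?_, hcy⟩
        rw [hasBit_eq, h y hcy] at hu
        exact absurd hu (by simp)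
      refine someIn_recFoldr (fun c acc hacc => someIn_cover_of_someIn _ _ _ _ hacc) hc ?_
      intro acc
      refine ih _ _ _ _ hjoin' ?_ ?_
      · intro m hm
        rcases List.mem_cons.1 hm with rfl | hm
        · exact hMQ hcM
        · exact hch m hm
      · rintro m hmM hma ⟨z, hz, hmz⟩
        by_cases hmc : c = m
        · subst hmc
          exact Or.inr fun i hi => by rw [Nat.testBit_or, hi, Bool.or_true]
        · rcases hcs m hmM hma ⟨z, List.mem_cons_of_mem _ hz, hmz⟩ with h | h
          · left
            rw [mem_recFilter]
            refine ⟨h, ?_⟩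
            have : c &&& m = Nat.shiftLeft 1 a := by
              refine Nat.eq_of_testBit_eq fun i => ?_
              have h2 : Nat.shiftLeft 1 a = 2 ^ a := Nat.one_shiftLeft a
              rw [h2, Nat.testBit_two_pow, Nat.testBit_and, Bool.eq_iff_iff, Bool.and_eq_true,
                decide_eq_true_eq]
              constructor
              · rintro ⟨h3, h4⟩
                exact hmeet c hcM m hmM hca hma hmc a i hca h3 hma h4
              · rintro rfl
                exact ⟨hca, hma⟩
            simp [this]
          · exact Or.inr fun i hi => by rw [Nat.testBit_or, h i hi, Bool.true_or]
    · exact ih _ _ _ _ hjoin' hch fun m hm hma ⟨z, hz, hmz⟩ =>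
        hcs m hm hma ⟨z, List.mem_cons_of_mem _ hz, hmz⟩

/-- `M` codes the lines of a plane on the points `0, …, n - 1` with `k` points on each line. -/
structure LineMasks (n k : ℕ) (M : Set ℕ) : Prop where
  lt : ∀ {m}, m ∈ M → ∀ i, m.testBit i → i < n
  count : ∀ {m}, m ∈ M → (List.range n).countP m.testBit = k
  join : ∀ {x y}, x < n → y < n → ∃ m ∈ M, m.testBit x ∧ m.testBit y
  meet : ∀ {c d}, c ∈ M → d ∈ M → c ≠ d → MeetAtMostOne c d

theorem countP_range_eq_card (n : ℕ) (p : ℕ → Bool) :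
    (List.range n).countP p = ((Finset.range n).filter fun i => p i).card := by
  rw [List.countP_eq_length_filter, ← List.toFinset_card_of_nodup (List.nodup_range.filter _),
    List.toFinset_filter, List.toFinset_range]

/-- A set contained in a line and of the same size is that line. -/
theorem LineMasks.mem_of_forall_testBit {n k : ℕ} {M : Set ℕ} (hM : LineMasks n k M) {ℓ m : ℕ}
    (hm : m ∈ M) (hℓ : ℓ < 2 ^ n) (hk : (List.range n).countP ℓ.testBit = k)
    (h : ∀ i < n, ℓ.testBit i → m.testBit i) : ℓ ∈ M := by
  have hsub : ((Finset.range n).filter fun i => ℓ.testBit i) ⊆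
      (Finset.range n).filter fun i => m.testBit i := by
    intro i hi
    rw [Finset.mem_filter, Finset.mem_range] at hi ⊢
    exact ⟨hi.1, h i hi.1 hi.2⟩
  have heq := Finset.eq_of_subset_of_card_le hsub (by
    rw [← countP_range_eq_card, ← countP_range_eq_card, hk, hM.count hm])
  have : ℓ = m := Nat.eq_of_testBit_eq fun i => by
    by_cases hi : i < n
    · have := congrArg (i ∈ ·) heq
      simpa [hi] using this
    · rw [Nat.testBit_lt_two_pow (hℓ.trans_le (Nat.pow_le_pow_right (by norm_num) (not_lt.1 hi)))]
      by_contra hne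
      exact hi (hM.lt hm i (by simpa using Ne.symm hne))
  exact this ▸ hm

/-- The line through `x` and `y` is `E`, because no other set meets the lines in `K` in at most
one point. -/
def Forces (n k : ℕ) (K : List ℕ) (x y E : ℕ) : Prop :=
  x < n ∧ y < n ∧ (∀ ℓ ∈ K, ¬ (hasBit ℓ x = true ∧ hasBit ℓ y = true)) ∧
    recFilter (fun c => hasBit c y) (candidates n K [] k x (joined x K)) = [E]

noncomputable instance (n k : ℕ) (K : List ℕ) (x y E : ℕ) : Decidable (Forces n k K x y E) :=
  inferInstanceAs (Decidable (_ ∧ _))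

/-- The line through `x` and `y` is none of the known lines, so it meets each of them at most once
and appears among the candidates. -/
theorem LineMasks.mem_of_forces {n k : ℕ} {M : Set ℕ} (hM : LineMasks n k M) {K : List ℕ}
    (hK : ∀ ℓ ∈ K, ℓ ∈ M) {x y E : ℕ} (h : Forces n k K x y E) : E ∈ M := by
  obtain ⟨hx, hy, hxy, hE⟩ := h
  obtain ⟨m, hm, hmx, hmy⟩ := hM.join hx hy
  have : m ∈ recFilter (fun c => hasBit c y) (candidates n K [] k x (joined x K)) := by
    rw [mem_recFilter, hasBit_eq]
    have hone : ∀ ℓ ∈ K, MeetAtMostOne ℓ m := by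
      intro ℓ hℓ
      refine hM.meet (hK ℓ hℓ) hm ?_
      rintro rfl
      exact hxy ℓ hℓ ⟨by rwa [hasBit_eq], by rwa [hasBit_eq]⟩
    refine ⟨mem_candidates (hM.lt hm) (hM.count hm) hmx hone (by simp) fun z hz hzx hj => ?_, hmy⟩
    obtain ⟨ℓ, hℓ, h1, h2⟩ := testBit_joined.1 hj
    exact hzx (hone ℓ hℓ z x h2 h1 hz hmx)
  rw [hE, List.mem_singleton] at this
  exact this ▸ hm

/-- Completes the partial plane `B` by lines through `s.1` which are taken from `s.2`. -/
noncomputable def pencils (m₀ : ℕ) (ys : List ℕ) (s : ℕ × List ℕ) (B : List ℕ)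
    (acc : List (List ℕ)) : List (List ℕ) :=
  cover s.1 ys (recFilter (fun c => recAll (meetsOne c) B) s.2) B (Nat.lor m₀ (joined s.1 B)) acc

/-- Completes each partial plane in a list by the lines through the points `s.1`, `s ∈ ss`. -/
noncomputable def grow (m₀ : ℕ) (ys : List ℕ) (ss : List (ℕ × List ℕ)) :
    List (List ℕ) → List (List ℕ) :=
  List.rec (fun Bs => Bs) (fun s _ ih Bs => ih (recFoldr (pencils m₀ ys s) [] Bs)) ss

/-- Some partial plane on the list always consists of lines of `M`. Its lines through the next point
count as covered, and each remaining line through that point meets all of its lines at most once, so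
the filter in `pencils` keeps it. -/
theorem someIn_grow {n k : ℕ} {M : Set ℕ} (hM : LineMasks n k M) {m₀ : ℕ} {ys : List ℕ}
    (hys : ∀ y ∈ ys, y < n) {ss : List (ℕ × List ℕ)}
    (hss : ∀ s ∈ ss, s.1 < n ∧ ∀ m ∈ M, m.testBit s.1 → (∃ y ∈ ys, m.testBit y) →
      m ∈ s.2 ∨ m = m₀) {Bs : List (List ℕ)} (h : SomeIn M Bs) : SomeIn M (grow m₀ ys ss Bs) := by
  induction ss generalizing Bs with
  | nil => exact h
  | cons s ss ih =>
    refine ih (fun s hs => hss s (List.mem_cons_of_mem _ hs)) ?_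
    obtain ⟨B, hB, hBM⟩ := h
    obtain ⟨hs, hcs⟩ := hss s (by simp)
    refine someIn_recFoldr (fun B acc hacc => someIn_cover_of_someIn _ _ _ _ hacc) hB fun acc => ?_
    refine someIn_cover (M := M) subset_rfl ys _ B _ acc (fun y hy => hM.join hs (hys y hy))
      (fun c hc d hd _ _ hcd => hM.meet hc hd hcd) hBM ?_
    intro m hm hms hmy
    have hlor : Nat.lor m₀ (joined s.1 B) = m₀ ||| joined s.1 B := rfl
    by_cases hmB : m ∈ B
    · refine Or.inr fun i hi => ?_
      rw [hlor, Nat.testBit_or, testBit_joined.2 ⟨m, hmB, hms, hi⟩, Bool.or_true]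
    · rcases hcs m hm hms hmy with h | rfl
      · left
        rw [mem_recFilter]
        refine ⟨h, recAll_of_forall fun b hb => meetsOne_of (hM.meet hm (hBM b hb) ?_)⟩
        rintro rfl
        exact hmB hb
      · exact Or.inr fun i hi => by rw [hlor, Nat.testBit_or, hi, Bool.true_or]

/-- Given the lines `K` of a plane and a line `m₀` of an orthogoval plane, tests that no third plane
is orthogoval to both: the second plane is completed at the points `as`, then the third one at the
points `as'`. -/
noncomputable def noThird (n k m₀ : ℕ) (K ys as ys' as' : List ℕ) : Bool :=
  (grow m₀ ys (as.map fun a => (a, candidates n [] K k a m₀)) [[m₀]]).all fun B =>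
    (grow 0 ys' (as'.map fun a => (a, recFilter (fun c => recAll (meetsTwo c) B)
      (recFilter (fun c => ys'.any (hasBit c)) (candidates n [] K k a 0)))) [[]]).isEmpty

/-- The search keeps a partial plane made of lines of `M`; relative to that one the search for the
third plane keeps one made of lines of `N`, so its result is not empty. -/
theorem noThird_eq_false {n k m₀ : ℕ} {K ys as ys' as' : List ℕ} {M N : Set ℕ}
    (hM : LineMasks n k M) (hN : LineMasks n k N) (hm₀ : m₀ ∈ M)
    (hKM : ∀ ℓ ∈ K, ∀ m ∈ M, MeetAtMostTwo ℓ m) (hKN : ∀ ℓ ∈ K, ∀ m ∈ N, MeetAtMostTwo ℓ m)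
    (hMN : ∀ m ∈ M, ∀ c ∈ N, MeetAtMostTwo m c) (hys : ∀ y ∈ ys, y < n) (hys' : ∀ y ∈ ys', y < n)
    (has : ∀ a ∈ as, a < n ∧ m₀.testBit a) (has' : ∀ a ∈ as', a < n) :
    noThird n k m₀ K ys as ys' as' = false := by
  obtain ⟨B, hB, hBM⟩ := someIn_grow hM (m₀ := m₀) hys
    (ss := as.map fun a => (a, candidates n [] K k a m₀)) (by
      intro s hs
      obtain ⟨a, ha, rfl⟩ := List.mem_map.1 hs
      refine ⟨(has a ha).1, fun m hm hma _ => ?_⟩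
      by_cases hmm : m = m₀
      · exact Or.inr hmm
      · refine Or.inl (mem_candidates (hM.lt hm) (hM.count hm) hma (by simp)
          (fun ℓ hℓ => hKM ℓ hℓ m hm) fun z hmz hza hz => ?_)
        exact hza (hM.meet hm hm₀ hmm z a hmz hma hz (has a ha).2))
    (Bs := [[m₀]]) ⟨[m₀], by simp, by simpa using hm₀⟩
  have hC := someIn_grow hN (m₀ := 0) hys'
    (ss := as'.map fun a => (a, recFilter (fun c => recAll (meetsTwo c) B)
      (recFilter (fun c => ys'.any (hasBit c)) (candidates n [] K k a 0)))) (by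
      intro s hs
      obtain ⟨a, ha, rfl⟩ := List.mem_map.1 hs
      refine ⟨has' a ha, fun m hm hma ⟨y, hy, hmy⟩ => Or.inl ?_⟩
      rw [mem_recFilter, mem_recFilter]
      refine ⟨⟨mem_candidates (hN.lt hm) (hN.count hm) hma (by simp)
          (fun ℓ hℓ => hKN ℓ hℓ m hm) (by simp), ?_⟩, recAll_of_forall fun b hb => ?_⟩
      · exact List.any_eq_true.2 ⟨y, hy, by rwa [hasBit_eq]⟩
      · refine meetsTwo_of fun x y z h1 h2 h3 h4 h5 h6 => ?_
        exact hMN b (hBM b hb) m hm x y z h4 h5 h6 h1 h2 h3)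
    (Bs := [[]]) ⟨[], by simp, by simp⟩
  obtain ⟨D, hD, -⟩ := hC
  rw [noThird, ← Bool.not_eq_true, List.all_eq_true]
  intro h
  have := h B hB
  rw [List.isEmpty_iff] at this
  rw [this] at hD
  simp at hD

/-! ### Coding planes on a labelled point set -/

section Mask

variable {P : Type*} {n : ℕ}

open Classical in
/-- The number that codes a set of points, given a labelling of the points. -/
noncomputable def mask (lab : Fin n → P) (s : Set P) : ℕ :=
  Nat.ofBits fun i => decide (lab i ∈ s)

theorem testBit_mask {lab : Fin n → P} {s : Set P} {i : ℕ} :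
    (mask lab s).testBit i ↔ ∃ h : i < n, lab ⟨i, h⟩ ∈ s := by
  by_cases hi : i < n
  · simp [mask, hi]
  · simp [mask, hi, Nat.testBit_ofBits_ge _ _ (not_lt.1 hi)]

theorem countP_mask {lab : Fin n → P} (hlab : lab.Bijective) (s : Set P) :
    (List.range n).countP (mask lab s).testBit = s.ncard := by
  rw [countP_range_eq_card, ← Set.ncard_coe_finset]
  refine Set.ncard_congr (fun i hi => lab ⟨i, Finset.mem_range.1 (Finset.mem_filter.1 hi).1⟩)
    ?_ ?_ ?_
  · intro i hi
    obtain ⟨_, h⟩ := testBit_mask.1 (Finset.mem_filter.1 hi).2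
    exact h
  · intro i j hi hj hij
    simpa using hlab.1 hij
  · intro x hx
    obtain ⟨i, rfl⟩ := hlab.2 x
    exact ⟨i, by simpa using testBit_mask.2 ⟨i.2, hx⟩, rfl⟩

theorem IsPlane.lineMasks {q : ℕ} {L : Set (Set P)} (hL : IsPlane q L) {lab : Fin n → P}
    (hlab : lab.Bijective) : LineMasks n (q + 1) (mask lab '' L) where
  lt := by
    rintro _ ⟨ℓ, hℓ, rfl⟩ i hi
    exact (testBit_mask.1 hi).1
  count := by
    rintro _ ⟨ℓ, hℓ, rfl⟩
    rw [countP_mask hlab, hL.ncard_line hℓ]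
  join := by
    intro x y hx hy
    obtain ⟨ℓ, hℓ, h1, h2⟩ := hL.join (lab ⟨x, hx⟩) (lab ⟨y, hy⟩)
    exact ⟨_, ⟨ℓ, hℓ, rfl⟩, testBit_mask.2 ⟨hx, h1⟩, testBit_mask.2 ⟨hy, h2⟩⟩
  meet := by
    rintro _ _ ⟨ℓ, hℓ, rfl⟩ ⟨m, hm, rfl⟩ hne x y h1 h2 h3 h4
    obtain ⟨hx, h1⟩ := testBit_mask.1 h1
    obtain ⟨hy, h2⟩ := testBit_mask.1 h2
    obtain ⟨_, h3⟩ := testBit_mask.1 h3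
    obtain ⟨_, h4⟩ := testBit_mask.1 h4
    by_contra hxy
    refine hne (congrArg _ (hL.eq_of_mem hℓ hm (x := lab ⟨x, hx⟩) (y := lab ⟨y, hy⟩) ?_ h1 h2 h3 h4))
    intro h
    exact hxy (by simpa using hlab.1 h)

/-- The mask `ℓ` need only be contained in a line, which suits masks that are prescribed by a
partial knowledge of the plane. -/
theorem AreOrthogoval.meetAtMostTwo {L M : Set (Set P)} (h : AreOrthogoval L M) {lab : Fin n → P}
    (hlab : lab.Injective) {ℓ m : ℕ} (hℓ : ∃ l ∈ L, ∀ i (h : i < n), ℓ.testBit i → lab ⟨i, h⟩ ∈ l)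
    (hm : m ∈ mask lab '' M) : MeetAtMostTwo ℓ m := by
  obtain ⟨l, hl, hsub⟩ := hℓ
  obtain ⟨m, hm, rfl⟩ := hm
  intro x y z h1 h2 h3 h4 h5 h6 hxy hxz hyz
  obtain ⟨hx, h4⟩ := testBit_mask.1 h4
  obtain ⟨hy, h5⟩ := testBit_mask.1 h5
  obtain ⟨hz, h6⟩ := testBit_mask.1 h6
  have hne : ∀ {i j : ℕ} (hi : i < n) (hj : j < n), i ≠ j → lab ⟨i, hi⟩ ≠ lab ⟨j, hj⟩ :=
    fun hi hj hij h => hij (by simpa using hlab h)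
  rcases h.isArc hm hl h4 (hsub x hx h1) h5 (hsub y hy h2) h6 (hsub z hz h3) (hne hx hy hxy)
    with h | h
  · exact hne _ _ hxz h.symm
  · exact hne _ _ hyz h.symm

theorem exists_of_mem_image_mask {L : Set (Set P)} {lab : Fin n → P} {ℓ : ℕ}
    (hℓ : ℓ ∈ mask lab '' L) : ∃ l ∈ L, ∀ i (h : i < n), ℓ.testBit i → lab ⟨i, h⟩ ∈ l := by
  obtain ⟨l, hl, rfl⟩ := hℓ
  exact ⟨l, hl, fun i h hi => (testBit_mask.1 hi).2⟩

/-- If the points of a plane `A` can be labelled in such a way that the lines `known` of `A` are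
prescribed, that they force the further lines `ext`, and that a line of an orthogoval plane `B` is
the prescribed set `m₀`, then a successful search shows that there is no third plane. -/
theorem false_of_noThird {q m₀ : ℕ} {A B C : Set (Set P)} (hA : IsPlane q A) (hB : IsPlane q B)
    (hC : IsPlane q C) (hAB : AreOrthogoval A B) (hAC : AreOrthogoval A C)
    (hBC : AreOrthogoval B C) {lab : Fin n → P} (hlab : lab.Bijective) {known : List ℕ}
    {ext : List (ℕ × ℕ × ℕ)}
    (hknown : ∀ ℓ ∈ known, ∃ l ∈ A, ∀ i (h : i < n), ℓ.testBit i → lab ⟨i, h⟩ ∈ l)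
    (hm₀ : ∃ b ∈ B, ∀ i (h : i < n), m₀.testBit i → lab ⟨i, h⟩ ∈ b)
    (hcount : ∀ ℓ ∈ m₀ :: known, ℓ < 2 ^ n ∧ (List.range n).countP ℓ.testBit = q + 1)
    (hext : ∀ t ∈ ext, Forces n (q + 1) known t.1 t.2.1 t.2.2)
    {ys as ys' as' : List ℕ} (hys : ∀ y ∈ ys, y < n) (hys' : ∀ y ∈ ys', y < n)
    (has : ∀ a ∈ as, a < n ∧ m₀.testBit a) (has' : ∀ a ∈ as', a < n)
    (h : noThird n (q + 1) m₀ (known ++ ext.map fun t => t.2.2) ys as ys' as' = true) : False := by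
  have hA' := hA.lineMasks hlab
  have hmem : ∀ {L : Set (Set P)}, IsPlane q L → ∀ ℓ ∈ m₀ :: known,
      (∃ l ∈ L, ∀ i (h : i < n), ℓ.testBit i → lab ⟨i, h⟩ ∈ l) → ℓ ∈ mask lab '' L := by
    rintro L hL ℓ hℓ ⟨l, hl, hsub⟩
    exact (hL.lineMasks hlab).mem_of_forall_testBit ⟨l, hl, rfl⟩ (hcount ℓ hℓ).1 (hcount ℓ hℓ).2
      fun i hi hℓi => testBit_mask.2 ⟨hi, hsub i hi hℓi⟩
  have hkn : ∀ ℓ ∈ known, ℓ ∈ mask lab '' A := fun ℓ hℓ =>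
    hmem hA ℓ (List.mem_cons_of_mem _ hℓ) (hknown ℓ hℓ)
  have hK : ∀ ℓ ∈ known ++ ext.map fun t => t.2.2, ℓ ∈ mask lab '' A := by
    intro ℓ hℓ
    rcases List.mem_append.1 hℓ with hℓ | hℓ
    · exact hkn ℓ hℓ
    · obtain ⟨t, ht, rfl⟩ := List.mem_map.1 hℓ
      exact hA'.mem_of_forces hkn (hext t ht)
  have := noThird_eq_false (hB.lineMasks hlab) (hC.lineMasks hlab)
    (hmem hB m₀ (by simp) hm₀)
    (fun ℓ hℓ m hm => hAB.meetAtMostTwo hlab.1 (exists_of_mem_image_mask (hK ℓ hℓ)) hm)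
    (fun ℓ hℓ m hm => hAC.meetAtMostTwo hlab.1 (exists_of_mem_image_mask (hK ℓ hℓ)) hm)
    (fun ℓ hℓ m hm => hBC.meetAtMostTwo hlab.1 (exists_of_mem_image_mask hℓ) hm)
    hys hys' has has'
  rw [h] at this
  exact absurd this (by simp)

end Mask

/-! ### Secants, tangents and involutions of an oval -/

/-- `sec a b` is the secant through the points `o a` and `o b` of an oval, the tangent if
`a = b`. -/
structure OvalLines {P : Type*} {k : ℕ} (A : Set (Set P)) (o : Fin k → P)
    (sec : Fin k → Fin k → Set P) : Prop where
  mem : ∀ a b, sec a b ∈ A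
  symm : ∀ a b, sec a b = sec b a
  left_mem : ∀ a b, o a ∈ sec a b
  eq_or_eq : ∀ {a b c}, o c ∈ sec a b → c = a ∨ c = b
  exists_sec : ∀ {X}, X ∉ Set.range o → ∀ a, ∃ b, X ∈ sec a b
  unique : ∀ {X}, X ∉ Set.range o → ∀ {a b c}, X ∈ sec a b → X ∈ sec a c → b = c

/-- For `X` off the oval, the line from `o a` to `X` either meets the oval again, in a single point,
or is the unique tangent at `o a`. Writing the tangent as `sec a a` makes the second index a
function of `a`. -/
theorem IsPlane.exists_ovalLines {P : Type*} [Finite P] {q : ℕ} {A : Set (Set P)}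
    (hA : IsPlane q A) (hq : 0 < q) {o : Fin (q + 1) → P} (ho : o.Injective)
    (harc : IsArc A (Set.range o)) : ∃ sec, OvalLines A o sec := by
  have hO : (Set.range o).ncard = q + 1 := by
    rw [← Set.image_univ, Set.ncard_image_of_injective _ ho, Set.ncard_univ, Nat.card_eq_fintype_card,
      Fintype.card_fin]
  choose tan htan using fun a => hA.exists_tangent hO (Set.mem_range_self a)
  choose jn hjn using fun a b => hA.join (o a) (o b)
  let sec : Fin (q + 1) → Fin (q + 1) → Set P := fun a b => if a = b then tan a else jn a b
  have hdiag : ∀ a, sec a a = tan a := fun a => if_pos rfl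
  have hne : ∀ a b, a ≠ b → sec a b = jn a b := fun a b h => if_neg h
  have hsec : ∀ a b, sec a b ∈ A ∧ o a ∈ sec a b ∧ o b ∈ sec a b := by
    intro a b
    by_cases h : a = b
    · subst h
      rw [hdiag]
      exact ⟨(htan a).1, (htan a).2.1, (htan a).2.1⟩
    · rw [hne a b h]
      exact hjn a b
  have hor : ∀ {a b c}, o c ∈ sec a b → c = a ∨ c = b := by
    intro a b c hc
    by_cases h : a = b
    · subst h
      rw [hdiag] at hc
      exact Or.inl (ho ((htan a).2.2 _ (Set.mem_range_self c) hc))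
    · have := harc (hsec a b).1 (Set.mem_range_self a) (hsec a b).2.1 (Set.mem_range_self b)
        (hsec a b).2.2 (Set.mem_range_self c) hc (ho.ne h)
      exact this.imp (fun h => ho h) (fun h => ho h)
  refine ⟨sec, fun a b => (hsec a b).1, ?_, fun a b => (hsec a b).2.1, hor, ?_, ?_⟩
  · intro a b
    by_cases h : a = b
    · rw [h]
    · exact hA.eq_of_mem (hsec a b).1 (hsec b a).1 (ho.ne h) (hsec a b).2.1 (hsec a b).2.2
        (hsec b a).2.2 (hsec b a).2.1
  · intro X hX a
    obtain ⟨ℓ, hℓ, haℓ, hXℓ⟩ := hA.join (o a) X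
    by_cases h : ∃ b, b ≠ a ∧ o b ∈ ℓ
    · obtain ⟨b, hb, hbℓ⟩ := h
      refine ⟨b, ?_⟩
      rwa [hA.eq_of_mem (hsec a b).1 hℓ (ho.ne hb) (hsec a b).2.2 (hsec a b).2.1 hbℓ haℓ]
    · push Not at h
      refine ⟨a, ?_⟩
      rw [hdiag, hA.tangent_unique hq harc hO (Set.mem_range_self a) (htan a).1 (htan a).2.1
        (htan a).2.2 hℓ haℓ]
      · exact hXℓ
      · rintro _ ⟨b, rfl⟩ hb
        by_contra hne
        exact h b (fun h => hne (h ▸ rfl)) hb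
  · intro X hX a b c hb hc
    have heq : sec a b = sec a c :=
      hA.eq_of_mem (hsec a b).1 (hsec a c).1 (x := X) (y := o a)
        (fun h => hX (h ▸ Set.mem_range_self a)) hb (hsec a b).2.1 hc (hsec a c).2.1
    have h1 := hor (heq ▸ (hsec a b).2.2 : o b ∈ sec a c)
    have h2 := hor (heq ▸ (hsec a c).2.2 : o c ∈ sec a b)
    rcases h1 with h1 | h1
    · rcases h2 with h2 | h2
      · rw [h1, h2]
      · exact h2.symm
    · exact h1

namespace OvalLines

variable {P : Type*} {A : Set (Set P)}

section

variable {k : ℕ} {o : Fin k → P} {sec : Fin k → Fin k → Set P}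

theorem relabel (h : OvalLines A o sec) (π : Equiv.Perm (Fin k)) :
    OvalLines A (fun a => o (π a)) (fun a b => sec (π a) (π b)) where
  mem a b := h.mem _ _
  symm a b := h.symm _ _
  left_mem a b := h.left_mem _ _
  eq_or_eq hc := (h.eq_or_eq hc).imp (fun h => π.injective h) (fun h => π.injective h)
  exists_sec := by
    intro X hX a
    obtain ⟨b, hb⟩ := h.exists_sec (X := X) (fun ⟨c, hc⟩ => hX ⟨π.symm c, by simpa using hc⟩) (π a)
    exact ⟨π.symm b, by simpa using hb⟩
  unique := by
    intro X hX a b c hb hc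
    exact π.injective (h.unique (X := X) (fun ⟨c, hc⟩ => hX ⟨π.symm c, by simpa using hc⟩) hb hc)

theorem meet (h : OvalLines A o sec) {q : ℕ} (hA : IsPlane q A) {a b c d : Fin k} (hac : a ≠ c)
    (had : a ≠ d) (hbc : b ≠ c) (hbd : b ≠ d) : ∃ X ∉ Set.range o, X ∈ sec a b ∧ X ∈ sec c d := by
  obtain ⟨X, h1, h2⟩ := hA.meet (h.mem a b) (h.mem c d)
  refine ⟨X, ?_, h1, h2⟩
  rintro ⟨e, rfl⟩
  rcases h.eq_or_eq h1 with rfl | rfl <;> rcases h.eq_or_eq h2 with rfl | rfl <;> contradiction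

theorem sec_ne (h : OvalLines A o sec) {a b c d : Fin k} (hac : a ≠ c) (had : a ≠ d) :
    sec a b ≠ sec c d := fun heq =>
  (h.eq_or_eq (heq ▸ h.left_mem a b : o a ∈ sec c d)).elim hac had

theorem meet_unique (h : OvalLines A o sec) {q : ℕ} (hA : IsPlane q A) {a b c d : Fin k}
    (hac : a ≠ c) (had : a ≠ d) {X Y : P} (hX : X ∈ sec a b) (hX' : X ∈ sec c d)
    (hY : Y ∈ sec a b) (hY' : Y ∈ sec c d) : X = Y := by
  by_contra hXY
  exact h.sec_ne hac had (hA.eq_of_mem (h.mem a b) (h.mem c d) hXY hX hY hX' hY')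

/-- Projection from `X`: `σ` sends an oval point to the other oval point on its line to `X`, and
fixes it if that line is a tangent. -/
theorem exists_perm (h : OvalLines A o sec) {X : P} (hX : X ∉ Set.range o) :
    ∃ σ : Equiv.Perm (Fin k), (∀ a, σ (σ a) = a) ∧ ∀ a, X ∈ sec a (σ a) := by
  choose σ hσ using h.exists_sec hX
  have hinv : ∀ a, σ (σ a) = a := fun a =>
    h.unique hX (hσ (σ a)) (h.symm a (σ a) ▸ hσ a)
  exact ⟨⟨σ, σ, hinv, hinv⟩, hinv, hσ⟩

/-- An involution of a set of odd size has a fixed point. -/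
theorem exists_tangent_of_odd (h : OvalLines A o sec) (hk : Odd k) {X : P}
    (hX : X ∉ Set.range o) : ∃ a, X ∈ sec a a := by
  obtain ⟨σ, hσ, hX'⟩ := h.exists_perm hX
  obtain ⟨a, ha⟩ := Equiv.Perm.exists_fixed_point_of_prime (p := 2) (n := 1) (σ := σ)
    (by simpa [← even_iff_two_dvd] using hk) (by ext a; simp [pow_two, hσ])
  exact ⟨a, by simpa [ha] using hX' a⟩

/-- An involution of a set of even size does not have exactly one fixed point. -/
theorem exists_tangent_ne_of_even (h : OvalLines A o sec) (hk : Even k) {X : P}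
    (hX : X ∉ Set.range o) {a : Fin k} (ha : X ∈ sec a a) : ∃ b ≠ a, X ∈ sec b b := by
  obtain ⟨σ, hσ, hX'⟩ := h.exists_perm hX
  obtain ⟨b, hb, hba⟩ := Equiv.Perm.exists_fixed_point_of_prime' (p := 2) (n := 1) (σ := σ)
    (by simpa [← even_iff_two_dvd] using hk) (by ext a; simp [pow_two, hσ])
    (h.unique hX (hX' a) ha)
  exact ⟨b, hba, by simpa [hb] using hX' b⟩

end

variable {q : ℕ} {o : Fin (q + 1) → P} {sec : Fin (q + 1) → Fin (q + 1) → Set P}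

/-- The tangents of an oval in a plane of even order are concurrent. -/
theorem exists_nucleus (h : OvalLines A o sec) (hA : IsPlane q A) (hq : Even q) (hq0 : 0 < q) :
    ∃ N ∉ Set.range o, ∀ a, N ∈ sec a a := by
  have hk : Odd (q + 1) := hq.add_one
  have h01 : (0 : Fin (q + 1)) ≠ Fin.last q := by
    simp [Fin.ext_iff]; omega
  obtain ⟨N, hN, h0, h1⟩ := h.meet hA h01 h01 h01 h01
  refine ⟨N, hN, fun c => ?_⟩
  obtain ⟨d, hd⟩ := h.exists_sec hN c
  by_cases hcd : c = d
  · subst hcd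
    exact hd
  exfalso
  -- Suppose that a secant `c d` passes through `N`. Each of its q+1 points lies on one of the q+1
  -- tangents, so mapping a tangent to its point on the secant is a bijection; but two tangents go
  -- to `N`.
  choose f hf hf' using fun a => hA.meet (h.mem a a) (h.mem c d)
  have huniq : ∀ a X, X ∈ sec a a → X ∈ sec c d → f a = X := by
    intro a X hX hX'
    by_contra hne
    have heq := hA.eq_of_mem (h.mem a a) (h.mem c d) hne (hf a) hX (hf' a) hX'
    have h1 := h.eq_or_eq (heq ▸ h.left_mem c d : o c ∈ sec a a)
    have h2 := h.eq_or_eq (heq ▸ h.symm c d ▸ h.left_mem d c : o d ∈ sec a a)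
    simp only [or_self] at h1 h2
    exact hcd (h1.trans h2.symm)
  have hsurj : Function.Surjective fun a => (⟨f a, hf' a⟩ : sec c d) := by
    rintro ⟨X, hX⟩
    by_cases hXo : X ∈ Set.range o
    · obtain ⟨e, rfl⟩ := hXo
      exact ⟨e, Subtype.ext (huniq e _ (h.left_mem e e) hX)⟩
    · obtain ⟨a, ha⟩ := h.exists_tangent_of_odd hk hXo
      exact ⟨a, Subtype.ext (huniq a _ ha hX)⟩
  have hbij := hsurj.bijective_of_nat_card_le (by
    rw [Nat.card_coe_set_eq, hA.ncard_line (h.mem c d), Nat.card_eq_fintype_card, Fintype.card_fin])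
  exact h01 (hbij.1 (Subtype.ext ((huniq _ N h0 hd).trans (huniq _ N h1 hd).symm)))

/-- In a plane of odd order, at most two tangents of an oval pass through a point. -/
theorem eq_of_mem_tangents (h : OvalLines A o sec) (hA : IsPlane q A) (hq : Odd q) {X : P}
    {a b c : Fin (q + 1)} (ha : X ∈ sec a a) (hb : X ∈ sec b b) (hc : X ∈ sec c c) (hab : a ≠ b)
    (hac : a ≠ c) : b = c := by
  have hk : Even (q + 1) := hq.add_one
  -- Each of the q points of the tangent at `a` other than `o a` lies on a second tangent, by
  -- parity. There are q other tangents, so they meet the tangent at `a` in distinct points.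
  choose f hf hf' using fun e => hA.meet (h.mem e e) (h.mem a a)
  have huniq : ∀ e X, e ≠ a → X ∈ sec e e → X ∈ sec a a → f e = X := fun e X he hX hX' =>
    h.meet_unique hA he he (hf e) (hf' e) hX hX'
  have hfne : ∀ e, e ≠ a → f e ≠ o a := by
    intro e he heq
    have := h.eq_or_eq (heq ▸ hf e : o a ∈ sec e e)
    simp only [or_self] at this
    exact he this.symm
  have hsurj : Function.Surjective fun e : {e // e ≠ a} =>
      (⟨f e, hf' e, hfne e e.2⟩ : (sec a a \ {o a} : Set P)) := by
    rintro ⟨X, hX, hXa⟩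
    have hXo : X ∉ Set.range o := by
      rintro ⟨e, rfl⟩
      have := h.eq_or_eq hX
      simp only [or_self] at this
      exact hXa (this ▸ rfl)
    obtain ⟨e, he, heX⟩ := h.exists_tangent_ne_of_even hk hXo hX
    exact ⟨⟨e, he⟩, Subtype.ext (huniq e _ he heX hX)⟩
  have hbij := hsurj.bijective_of_nat_card_le (by
    rw [Nat.card_coe_set_eq, Set.ncard_sdiff_singleton_of_mem (h.left_mem a a),
      hA.ncard_line (h.mem a a)]
    simp)
  have := @hbij.1 ⟨b, hab.symm⟩ ⟨c, hac.symm⟩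
    (Subtype.ext ((huniq b X hab.symm hb ha).trans (huniq c X hac.symm hc ha).symm))
  simpa using this

end OvalLines

/-- The incidence of the labelled points with the secant or tangent of an oval through its points
`a` and `b`: first come the points of the oval, then the points off the oval, which are given by
the involutions that they induce on the oval. -/
def labelInc {k r : ℕ} (T : Fin r → Fin k → Fin k) (a b : Fin k) : Fin (k + r) → Bool :=
  Fin.append (fun c => decide (c = a ∨ c = b)) (fun z => decide (T z a = b))

/-- The secants and tangents of an oval, as sets of labels. -/
def secantMasks {k r : ℕ} (T : Fin r → Fin k → Fin k) : List ℕ :=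
  (List.finRange k).flatMap fun a => ((List.finRange k).filter (a ≤ ·)).map fun b =>
    Nat.ofBits (labelInc T a b)

/-- Distinct involutions come from distinct points, so the oval and the points `x z` account for all
q² + q + 1 points. In this labelling the secants and tangents are explicit: `x z` lies on `sec a b`
when `T z a = b`. The oval is the mask `2 ^ (q + 1) - 1`, a line of `B`. -/
theorem false_of_involutions {P : Type*} [Finite P] {q : ℕ} {A B C : Set (Set P)}
    (hA : IsPlane q A) (hB : IsPlane q B) (hC : IsPlane q C) (hAB : AreOrthogoval A B)
    (hAC : AreOrthogoval A C) (hBC : AreOrthogoval B C) {o : Fin (q + 1) → P} (ho : o.Injective)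
    (hoB : ∃ b ∈ B, ∀ a, o a ∈ b) {sec : Fin (q + 1) → Fin (q + 1) → Set P}
    (h : OvalLines A o sec) {T : Fin (q ^ 2) → Fin (q + 1) → Fin (q + 1)} (hT : T.Injective)
    (hx : ∀ z, ∃ X ∉ Set.range o, ∀ a, X ∈ sec a (T z a)) {known : List ℕ}
    {ext : List (ℕ × ℕ × ℕ)} (hknown : secantMasks T = known)
    (hcount : ∀ ℓ ∈ (2 ^ (q + 1) - 1) :: known,
      ℓ < 2 ^ (q + 1 + q ^ 2) ∧ (List.range (q + 1 + q ^ 2)).countP ℓ.testBit = q + 1)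
    (hext : ∀ t ∈ ext, Forces (q + 1 + q ^ 2) (q + 1) known t.1 t.2.1 t.2.2)
    {ys as ys' as' : List ℕ} (hys : ∀ y ∈ ys, y < q + 1 + q ^ 2)
    (hys' : ∀ y ∈ ys', y < q + 1 + q ^ 2) (has : ∀ a ∈ as, a < q + 1)
    (has' : ∀ a ∈ as', a < q + 1 + q ^ 2)
    (hsearch : noThird (q + 1 + q ^ 2) (q + 1) (2 ^ (q + 1) - 1) (known ++ ext.map fun t => t.2.2)
      ys as ys' as' = true) : False := by
  choose x hxo hx using hx
  have hinj : Function.Injective (Fin.append o x) := by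
    rw [Fin.append_injective_iff]
    refine ⟨ho, fun z w hzw => hT (funext fun a => ?_), fun a z haz => hxo z ⟨a, haz⟩⟩
    exact h.unique (hxo z) (hx z a) (hzw ▸ hx w a)
  have hbij : Function.Bijective (Fin.append o x) := hinj.bijective_of_nat_card_le (by
    rw [hA.card_points, Nat.card_eq_fintype_card, Fintype.card_fin]
    omega)
  refine false_of_noThird hA hB hC hAB hAC hBC hbij (known := known) (ext := ext) ?_ ?_ hcount hext
    hys hys' (fun a ha => ⟨by have := has a ha; omega, ?_⟩) has' hsearch
  · intro ℓ hℓ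
    rw [← hknown, secantMasks, List.mem_flatMap] at hℓ
    obtain ⟨a, -, hℓ⟩ := hℓ
    obtain ⟨b, -, rfl⟩ := List.mem_map.1 hℓ
    refine ⟨sec a b, h.mem a b, fun i hi hbit => ?_⟩
    rw [Nat.testBit_ofBits_lt _ _ hi] at hbit
    generalize (⟨i, hi⟩ : Fin (q + 1 + q ^ 2)) = j at hbit ⊢
    induction j using Fin.addCases with
    | left c =>
      rw [labelInc, Fin.append_left, decide_eq_true_eq] at hbit
      rw [Fin.append_left]
      rcases hbit with rfl | rfl
      · exact h.left_mem _ _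
      · exact h.symm a _ ▸ h.left_mem _ _
    | right z =>
      rw [labelInc, Fin.append_right, decide_eq_true_eq] at hbit
      rw [Fin.append_right, ← hbit]
      exact hx z a
  · obtain ⟨b, hb, hob⟩ := hoB
    refine ⟨b, hb, fun i hi hbit => ?_⟩
    rw [Nat.testBit_two_pow_sub_one, decide_eq_true_eq] at hbit
    have : (⟨i, hi⟩ : Fin (q + 1 + q ^ 2)) = Fin.castAdd _ ⟨i, hbit⟩ := rfl
    rw [this, Fin.append_left]
    exact hob _
  · rw [Nat.testBit_two_pow_sub_one, decide_eq_true_eq]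
    exact has a ha

/-- Any line of `B` serves as the oval of `A`. -/
theorem exists_oval {P : Type*} [Finite P] {q : ℕ} (hq : 0 < q) {A B : Set (Set P)}
    (hA : IsPlane q A) (hB : IsPlane q B) (hAB : AreOrthogoval A B) :
    ∃ (o : Fin (q + 1) → P) (sec : Fin (q + 1) → Fin (q + 1) → Set P), o.Injective ∧
      (∃ b ∈ B, ∀ a, o a ∈ b) ∧ OvalLines A o sec := by
  have : Nonempty P := by
    have : 0 < Nat.card P := by rw [hA.card_points]; omega
    exact (Nat.card_pos_iff.1 this).1
  obtain ⟨x⟩ := this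
  obtain ⟨b, hb, -⟩ := hB.join x x
  have hcard : Nat.card b = q + 1 := by rw [Nat.card_coe_set_eq, hB.ncard_line hb]
  let e : Fin (q + 1) ≃ b := (Finite.equivFinOfCardEq hcard).symm
  have hinj : Function.Injective fun a => (e a : P) := Subtype.val_injective.comp e.injective
  obtain ⟨sec, hsec⟩ := hA.exists_ovalLines hq hinj (fun {ℓ} hℓ {x y z} hx hx' hy hy' hz hz' => by
    have hsub : Set.range (fun a => (e a : P)) ⊆ b := by
      rintro _ ⟨a, rfl⟩
      exact (e a).2
    exact hAB.isArc hb hℓ (hsub hx) hx' (hsub hy) hy' (hsub hz) hz')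
  exact ⟨fun a => e a, sec, hinj, ⟨b, hb, fun a => (e a).2⟩, hsec⟩

namespace OvalLines

variable {P : Type*} {A : Set (Set P)}

/-- Two lines determine the point: the involution induced by the intersection of `sec a (f a)` and
`sec c (f c)` agrees with `f` on these points, and at most one point is left, which it must fix. The
case `f c = c` is allowed and is the one needed for order two. -/
theorem exists_of_involution {k q : ℕ} {o : Fin k → P} {sec : Fin k → Fin k → Set P}
    (h : OvalLines A o sec) (hA : IsPlane q A) {f : Fin k → Fin k} {a c : Fin k} (hac : a ≠ c)
    (hac' : a ≠ f c) (hbc : f a ≠ c) (hbd : f a ≠ f c) (ha : f (f a) = a) (hc : f (f c) = c)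
    (hf : ∀ i, i = a ∨ i = f a ∨ i = c ∨ i = f c ∨
      (f i = i ∧ ∀ j, j = a ∨ j = f a ∨ j = c ∨ j = f c ∨ j = i)) :
    ∃ X ∉ Set.range o, ∀ i, X ∈ sec i (f i) := by
  obtain ⟨X, hX, h1, h2⟩ := h.meet hA hac hac' hbc hbd
  obtain ⟨σ, hσ, hXσ⟩ := h.exists_perm hX
  have ha' : σ a = f a := h.unique hX (hXσ a) h1
  have hc' : σ c = f c := h.unique hX (hXσ c) h2
  have hfa : σ (f a) = a := by rw [← ha', hσ]
  have hfc : σ (f c) = c := by rw [← hc', hσ]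
  refine ⟨X, hX, fun i => ?_⟩
  have key : σ i = f i := by
    rcases hf i with rfl | rfl | rfl | rfl | ⟨hi, hall⟩
    · exact ha'
    · rw [hfa, ha]
    · exact hc'
    · rw [hfc, hc]
    · rw [hi]
      by_cases hi' : i = a ∨ i = f a ∨ i = c ∨ i = f c
      · rcases hi' with rfl | rfl | rfl | rfl
        · rw [ha', hi]
        · rw [hfa]; exact hi ▸ ha.symm
        · rw [hc', hi]
        · rw [hfc]; exact hi ▸ hc.symm
      · push Not at hi'
        have hi2 : ∀ j, σ i = j → i = σ j := fun j hj => by rw [← hj, hσ]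
        rcases hall (σ i) with hj | hj | hj | hj | hj
        · exact absurd ((hi2 _ hj).trans ha') hi'.2.1
        · exact absurd ((hi2 _ hj).trans hfa) hi'.1
        · exact absurd ((hi2 _ hj).trans hc') hi'.2.2.2
        · exact absurd ((hi2 _ hj).trans hfc) hi'.2.2.1
        · exact hj
  rw [← key]
  exact hXσ i

theorem exists_of_involutions {q r : ℕ} {o : Fin (q + 1) → P}
    {sec : Fin (q + 1) → Fin (q + 1) → Set P} (h : OvalLines A o sec) (hA : IsPlane q A)
    (hq : Even q) (hq0 : 0 < q) {T : Fin r → Fin (q + 1) → Fin (q + 1)}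
    (hT : ∀ z, (∀ a, T z a = a) ∨ ∃ a c, a ≠ c ∧ a ≠ T z c ∧ T z a ≠ c ∧ T z a ≠ T z c ∧
      T z (T z a) = a ∧ T z (T z c) = c ∧ ∀ i, i = a ∨ i = T z a ∨ i = c ∨ i = T z c ∨
        (T z i = i ∧ ∀ j, j = a ∨ j = T z a ∨ j = c ∨ j = T z c ∨ j = i)) (z : Fin r) :
    ∃ X ∉ Set.range o, ∀ a, X ∈ sec a (T z a) := by
  rcases hT z with hz | ⟨a, c, h1, h2, h3, h4, h5, h6, h7⟩
  · obtain ⟨N, hN, hN'⟩ := h.exists_nucleus hA hq hq0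
    exact ⟨N, hN, fun a => by rw [hz]; exact hN' a⟩
  · exact h.exists_of_involution hA h1 h2 h3 h4 h5 h6 h7

end OvalLines

/-! ### Orders two and four -/

/-- The involutions that the points off an oval induce on it, in the plane of order 2. -/
def involutionsTwo : Fin (2 ^ 2) → Fin (2 + 1) → Fin (2 + 1) :=
  ![![0, 1, 2], ![1, 0, 2], ![0, 2, 1], ![2, 1, 0]]

/-- The secants and tangents of the oval. -/
def secantsTwo : List ℕ :=
  [41, 19, 69, 74, 38, 28]

/-- The lines that do not meet the oval, each with two of its points. -/
def externalsTwo : List (ℕ × ℕ × ℕ) :=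
  [(4, 5, 112)]

/-- The involutions that the points off an oval induce on it, in the plane of order 4. -/
def involutionsFour : Fin (4 ^ 2) → Fin (4 + 1) → Fin (4 + 1) :=
  ![![0, 1, 2, 3, 4], ![1, 0, 3, 2, 4], ![1, 0, 4, 3, 2], ![1, 0, 2, 4, 3], ![2, 3, 0, 1, 4], ![2,
  4, 0, 3, 1], ![2, 1, 0, 4, 3], ![3, 2, 1, 0, 4], ![3, 4, 2, 0, 1], ![3, 1, 4, 0, 2], ![4, 2, 1,
  3, 0], ![4, 3, 2, 1, 0], ![4, 1, 3, 2, 0], ![0, 2, 1, 4, 3], ![0, 3, 4, 1, 2], ![0, 4, 3, 2, 1]]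

/-- The secants and tangents of the oval. -/
def secantsFour : List ℕ :=
  [1835041, 451, 3589, 28681, 229393, 149538, 299014, 590346, 1057810, 74020, 1179724, 540820,
  33960, 264472, 4720]

/-- The lines that do not meet the oval, each with two of its points. -/
def externalsFour : List (ℕ × ℕ × ℕ) :=
  [(6, 10, 345152), (7, 9, 402048), (6, 11, 567360), (8, 10, 660736), (8, 9, 1098496), (7, 11,
  1120384)]

/-- No three projective planes of order two are mutually orthogoval. -/
theorem false_of_order_two {P : Type*} [Finite P] {A B C : Set (Set P)} (hA : IsPlane 2 A)
    (hB : IsPlane 2 B) (hC : IsPlane 2 C) (hAB : AreOrthogoval A B) (hAC : AreOrthogoval A C)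
    (hBC : AreOrthogoval B C) : False := by
  obtain ⟨o, sec, ho, hoB, h⟩ := exists_oval (by norm_num) hA hB hAB
  exact false_of_involutions hA hB hC hAB hAC hBC ho hoB h (T := involutionsTwo)
    (by decide +kernel)
    (h.exists_of_involutions hA (by decide) (by norm_num) (by decide +kernel))
    (known := secantsTwo) (ext := externalsTwo)
    (ys := [6, 5, 4, 3, 2, 1, 0]) (as := [0, 1, 2])
    -- The pencils of `C` at five points are searched; in orders four and five one line of `C` is
    -- enough.
    (ys' := [6, 5, 4, 3, 2, 1, 0]) (as' := [0, 1, 2, 3, 4]) (by decide +kernel)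
    (by decide +kernel) (by decide +kernel) (by decide) (by decide) (by decide) (by decide)
    (by decide +kernel)

/-- No three projective planes of order four are mutually orthogoval. -/
theorem false_of_order_four {P : Type*} [Finite P] {A B C : Set (Set P)} (hA : IsPlane 4 A)
    (hB : IsPlane 4 B) (hC : IsPlane 4 C) (hAB : AreOrthogoval A B) (hAC : AreOrthogoval A C)
    (hBC : AreOrthogoval B C) : False := by
  obtain ⟨o, sec, ho, hoB, h⟩ := exists_oval (by norm_num) hA hB hAB
  exact false_of_involutions hA hB hC hAB hAC hBC ho hoB h (T := involutionsFour)
    (by decide +kernel)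
    (h.exists_of_involutions hA (by decide) (by norm_num) (by decide +kernel))
    (known := secantsFour) (ext := externalsFour)
    (ys := [19, 18, 20, 5, 9, 17, 11, 12, 10, 6, 15, 7, 16, 14, 8, 13]) (as := [0, 1, 2, 3, 4])
    -- Already the line of `C` that joins the points 0 and 1 of the oval is impossible: no set of
    -- five points through both meets all lines of `A` and of the completed `B` in at most two
    -- points.
    (ys' := [1]) (as' := [0]) (by decide +kernel)
    (by decide +kernel) (by decide +kernel) (by decide) (by decide) (by decide) (by decide)
    (by decide +kernel)

/-! ### Order five: exterior and interior points of an oval -/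

namespace OvalLines

variable {P : Type*} {A : Set (Set P)} {o : Fin 6 → P} {sec : Fin 6 → Fin 6 → Set P}

/-- The secant through `o c` and `o d` passes through the intersection of the tangents at `o a` and
`o b`. -/
def Ext (o : Fin 6 → P) (sec : Fin 6 → Fin 6 → Set P) (a b c d : Fin 6) : Prop :=
  ∃ X ∉ Set.range o, X ∈ sec a a ∧ X ∈ sec b b ∧ X ∈ sec c d

/-- The point common to the tangents at `a` and `b` lies on no third tangent, so its line through `o
c` meets the oval in a fourth point. -/
theorem exists_ext (h : OvalLines A o sec) (hA : IsPlane 5 A) {a b c : Fin 6} (hab : a ≠ b)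
    (hac : a ≠ c) (hbc : b ≠ c) : ∃ d, d ≠ a ∧ d ≠ b ∧ d ≠ c ∧ Ext o sec a b c d := by
  obtain ⟨X, hX, ha, hb⟩ := h.meet hA hab hab hab hab
  obtain ⟨d, hd⟩ := h.exists_sec hX c
  refine ⟨d, ?_, ?_, ?_, X, hX, ha, hb, hd⟩
  · rintro rfl
    exact hac (h.unique hX ha (h.symm c d ▸ hd))
  · rintro rfl
    exact hbc (h.unique hX hb (h.symm c d ▸ hd))
  · rintro rfl
    exact hbc (h.eq_of_mem_tangents (q := 5) hA (by decide) ha hb hd hab hac)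

theorem ext_unique (h : OvalLines A o sec) (hA : IsPlane 5 A) {a b c d e : Fin 6} (hab : a ≠ b)
    (hd : Ext o sec a b c d) (he : Ext o sec a b c e) : d = e := by
  obtain ⟨X, hX, hXa, hXb, hXd⟩ := hd
  obtain ⟨Y, hY, hYa, hYb, hYe⟩ := he
  have := h.meet_unique hA hab hab hXa hXb hYa hYb
  subst this
  exact h.unique hX hXd hYe

theorem forall_eq_of_nodup {a b c d e f : Fin 6} (hn : [a, b, c, d, e, f].Nodup) (i : Fin 6) :
    i = a ∨ i = b ∨ i = c ∨ i = d ∨ i = e ∨ i = f := by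
  have : i ∈ [a, b, c, d, e, f].toFinset := by
    rw [Finset.eq_univ_of_card _ (List.toFinset_card_of_nodup hn)]
    exact Finset.mem_univ i
  simpa using this

/-- The involution of `X` fixes `a` and `b` and swaps `c` and `d`. It cannot fix `e`, since no point
lies on three tangents, so it swaps `e` and `f`. -/
theorem mem_of_ext (h : OvalLines A o sec) (hA : IsPlane 5 A) {a b c d e f : Fin 6}
    (hn : [a, b, c, d, e, f].Nodup) {X : P} (hX : X ∉ Set.range o) (ha : X ∈ sec a a)
    (hb : X ∈ sec b b) (hd : X ∈ sec c d) : X ∈ sec e f := by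
  have hall := forall_eq_of_nodup hn
  obtain ⟨g, hg⟩ := h.exists_sec hX e
  simp only [List.nodup_cons, List.mem_cons, List.not_mem_nil, or_false, not_or] at hn
  have hg' := h.symm e g ▸ hg
  rcases hall g with rfl | rfl | rfl | rfl | rfl | rfl
  · exact absurd (h.unique hX ha hg') (by tauto)
  · exact absurd (h.unique hX hb hg') (by tauto)
  · exact absurd (h.unique hX hd hg') (by tauto)
  · exact absurd (h.unique hX (h.symm c g ▸ hd) hg') (by tauto)
  · exact absurd (h.eq_of_mem_tangents (q := 5) hA (by decide) ha hb hg (by tauto) (by tauto))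
      (by tauto)
  · exact hg

/-- Let `Y` be the intersection of `sec a b` and `sec c d`. It is not on `sec e f`, which meets `sec
c d` only in `X`, and `X` is not on `sec a b`. The lines from `Y` to `a`, `b`, `c`, `d` being used
up, those to `e` and `f` are tangents. -/
theorem ext_swap (h : OvalLines A o sec) (hA : IsPlane 5 A) {a b c d e f : Fin 6}
    (hn : [a, b, c, d, e, f].Nodup) (hE : Ext o sec a b c d) :
    Ext o sec e f a b ∧ Ext o sec e f c d := by
  have hall := forall_eq_of_nodup hn
  obtain ⟨X, hX, ha, hb, hd⟩ := hE
  have hef := h.mem_of_ext hA hn hX ha hb hd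
  simp only [List.nodup_cons, List.mem_cons, List.not_mem_nil, or_false, not_or] at hn
  obtain ⟨Y, hY, hab, hcd⟩ := h.meet hA (a := a) (b := b) (c := c) (d := d) (by tauto) (by tauto)
    (by tauto) (by tauto)
  have hYef : Y ∉ sec e f := by
    intro hYe
    have := h.meet_unique hA (by tauto) (by tauto) hYe hcd hef hd
    subst this
    exact absurd (h.unique hX ha hab) (by tauto)
  have key : ∀ {i j}, (i = e ∧ j = f ∨ i = f ∧ j = e) → Y ∈ sec i i := by
    intro i j hij
    obtain ⟨g, hg⟩ := h.exists_sec hY i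
    have hg' := h.symm i g ▸ hg
    have h1 := h.symm a b ▸ hab
    have h2 := h.symm c d ▸ hcd
    have hj : g ≠ j := by
      rintro rfl
      rcases hij with ⟨rfl, rfl⟩ | ⟨rfl, rfl⟩
      · exact hYef hg
      · exact hYef hg'
    have hi : g = i := by
      rcases hall g with rfl | rfl | rfl | rfl | hg2
      · exact absurd (h.unique hY hab hg') (by rcases hij with ⟨rfl, rfl⟩ | ⟨rfl, rfl⟩ <;> tauto)
      · exact absurd (h.unique hY h1 hg') (by rcases hij with ⟨rfl, rfl⟩ | ⟨rfl, rfl⟩ <;> tauto)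
      · exact absurd (h.unique hY hcd hg') (by rcases hij with ⟨rfl, rfl⟩ | ⟨rfl, rfl⟩ <;> tauto)
      · exact absurd (h.unique hY h2 hg') (by rcases hij with ⟨rfl, rfl⟩ | ⟨rfl, rfl⟩ <;> tauto)
      · rcases hij with ⟨rfl, rfl⟩ | ⟨rfl, rfl⟩ <;> tauto
    exact hi ▸ (hi ▸ hg)
  have he : Y ∈ sec e e := key (j := f) (by tauto)
  have hf : Y ∈ sec f f := key (j := e) (by tauto)
  exact ⟨⟨Y, hY, he, hf, hab⟩, Y, hY, he, hf, hcd⟩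

/-- The three ways in which a partition of an oval into pairs gives exterior points. -/
theorem ext_all (h : OvalLines A o sec) (hA : IsPlane 5 A) {a b c d e f : Fin 6}
    (hn : [a, b, c, d, e, f].Nodup) (hE : Ext o sec a b c d) :
    Ext o sec e f a b ∧ Ext o sec c d a b := by
  refine ⟨(h.ext_swap hA hn hE).1, ?_⟩
  obtain ⟨X, hX, ha, hb, hd⟩ := hE
  -- `X` lies on `sec e f` as well, so the pairs `c d` and `e f` may be exchanged.
  refine (h.ext_swap hA (e := c) (f := d) (c := e) (d := f) ?_
    ⟨X, hX, ha, hb, h.mem_of_ext hA hn hX ha hb hd⟩).1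
  simp only [List.nodup_cons, List.mem_cons, List.not_mem_nil, or_false, not_or] at hn ⊢
  tauto

theorem Ext.relabel {π : Equiv.Perm (Fin 6)} {a b c d : Fin 6}
    (hE : Ext o sec (π a) (π b) (π c) (π d)) :
    Ext (fun a => o (π a)) (fun a b => sec (π a) (π b)) a b c d := by
  obtain ⟨X, hX, hE⟩ := hE
  exact ⟨X, fun ⟨i, hi⟩ => hX ⟨π i, hi⟩, hE⟩

/-- The points of an oval in a plane of order five can be labelled in such a way that two given
secants pass through the intersections of certain tangents. -/
theorem exists_relabel (h : OvalLines A o sec) (hA : IsPlane 5 A) :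
    ∃ π : Equiv.Perm (Fin 6), Ext (fun a => o (π a)) (fun a b => sec (π a) (π b)) 0 1 2 3 ∧
      Ext (fun a => o (π a)) (fun a b => sec (π a) (π b)) 0 2 1 4 := by
  obtain ⟨π, hπ⟩ : ∃ π : Equiv.Perm (Fin 6),
      Ext (fun a => o (π a)) (fun a b => sec (π a) (π b)) 0 1 2 3 := by
    obtain ⟨d, h0, h1, h2, hd⟩ := h.exists_ext hA (a := 0) (b := 1) (c := 2) (by decide) (by decide)
      (by decide)
    refine ⟨Equiv.swap 3 d, Ext.relabel ?_⟩
    rwa [Equiv.swap_apply_left, Equiv.swap_apply_of_ne_of_ne (by decide) h0.symm,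
      Equiv.swap_apply_of_ne_of_ne (by decide) h1.symm,
      Equiv.swap_apply_of_ne_of_ne (by decide) h2.symm]
  have h' := h.relabel π
  obtain ⟨d, h0, h2, h1, hd⟩ := h'.exists_ext hA (a := 0) (b := 2) (c := 1) (by decide) (by decide)
    (by decide)
  -- The partitions 01|23|45 and 02|13|45 share the pair 45, whose tangents meet in only one point.
  have hd3 : d ≠ 3 := by
    rintro rfl
    have h3 := (h'.ext_all hA (e := 4) (f := 5) (by decide) hπ).1
    have h4 := (h'.ext_all hA (e := 4) (f := 5) (by decide) hd).1
    exact absurd (h'.ext_unique hA (by decide) h3 h4) (by decide)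
  -- Here `d` is 4 or 5, so the swap does not disturb 0, 1, 2, 3.
  refine ⟨π * Equiv.swap 4 d, ?_, ?_⟩
  · obtain ⟨X, hX, hE⟩ := hπ
    refine Ext.relabel (o := o) (sec := sec) ⟨X, fun ⟨i, hi⟩ => hX ⟨π.symm i, by simpa using hi⟩, ?_⟩
    simp only [Equiv.Perm.mul_apply]
    rwa [Equiv.swap_apply_of_ne_of_ne (by decide) h0.symm,
      Equiv.swap_apply_of_ne_of_ne (by decide) h1.symm,
      Equiv.swap_apply_of_ne_of_ne (by decide) h2.symm,
      Equiv.swap_apply_of_ne_of_ne (by decide) hd3.symm]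
  · obtain ⟨X, hX, hE⟩ := hd
    refine Ext.relabel (o := o) (sec := sec) ⟨X, fun ⟨i, hi⟩ => hX ⟨π.symm i, by simpa using hi⟩, ?_⟩
    simp only [Equiv.Perm.mul_apply]
    rwa [Equiv.swap_apply_left, Equiv.swap_apply_of_ne_of_ne (by decide) h0.symm,
      Equiv.swap_apply_of_ne_of_ne (by decide) h1.symm,
      Equiv.swap_apply_of_ne_of_ne (by decide) h2.symm]

/-- The exterior points are determined by the labelling. -/
theorem ext_five (h : OvalLines A o sec) (hA : IsPlane 5 A) (h1 : Ext o sec 0 1 2 3)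
    (h2 : Ext o sec 0 2 1 4) : Ext o sec 0 3 1 5 ∧ Ext o sec 0 4 1 3 ∧ Ext o sec 0 5 1 2 := by
  have a1 := h.ext_all hA (e := 4) (f := 5) (by decide) h1
  have a2 := h.ext_all hA (e := 3) (f := 5) (by decide) h2
  -- A pair of oval points occurs in only one of the partitions. For each of the pairs 03, 04, 05
  -- this excludes two of the three ways to split the rest, leaving 03|15|24, 04|13|25 and 05|12|34.
  have h3 : Ext o sec 0 3 1 5 := by
    obtain ⟨d, d0, d1, d2, hd⟩ := h.exists_ext hA (a := 0) (b := 3) (c := 1) (by decide) (by decide)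
      (by decide)
    have e2 : d ≠ 2 := by
      rintro rfl
      have := (h.ext_all hA (e := 4) (f := 5) (by decide) hd).1
      exact absurd (h.ext_unique hA (by decide) a1.1 this) (by decide)
    have e4 : d ≠ 4 := by
      rintro rfl
      have := (h.ext_all hA (e := 2) (f := 5) (by decide) hd).2
      exact absurd (h.ext_unique hA (by decide) a2.2 this) (by decide)
    have : d = 5 := by omega
    rwa [this] at hd
  have a3 := h.ext_all hA (e := 2) (f := 4) (by decide) h3
  have h4 : Ext o sec 0 4 1 3 := by
    obtain ⟨d, d0, d1, d2, hd⟩ := h.exists_ext hA (a := 0) (b := 4) (c := 1) (by decide) (by decide)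
      (by decide)
    have e2 : d ≠ 2 := by
      rintro rfl
      have := (h.ext_all hA (e := 3) (f := 5) (by decide) hd).1
      exact absurd (h.ext_unique hA (by decide) a2.1 this) (by decide)
    have e4 : d ≠ 5 := by
      rintro rfl
      have := (h.ext_all hA (e := 2) (f := 3) (by decide) hd).2
      exact absurd (h.ext_unique hA (by decide) a3.2 this) (by decide)
    have : d = 3 := by omega
    rwa [this] at hd
  have a4 := h.ext_all hA (e := 2) (f := 5) (by decide) h4
  refine ⟨h3, h4, ?_⟩
  obtain ⟨d, d0, d1, d2, hd⟩ := h.exists_ext hA (a := 0) (b := 5) (c := 1) (by decide) (by decide)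
    (by decide)
  have e2 : d ≠ 3 := by
    rintro rfl
    have := (h.ext_all hA (e := 2) (f := 4) (by decide) hd).2
    exact absurd (h.ext_unique hA (by decide) a4.2 this) (by decide)
  have e4 : d ≠ 4 := by
    rintro rfl
    have := (h.ext_all hA (e := 2) (f := 3) (by decide) hd).2
    exact absurd (h.ext_unique hA (by decide) a2.2 this) (by decide)
  have : d = 2 := by omega
  rwa [this] at hd

theorem exists_exterior (h : OvalLines A o sec) (hA : IsPlane 5 A) {a b c d e f : Fin 6}
    {g : Fin 6 → Fin 6} (hE : Ext o sec a b c d) (hn : [a, b, c, d, e, f].Nodup)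
    (hg : g a = a ∧ g b = b ∧ g c = d ∧ g d = c ∧ g e = f ∧ g f = e) :
    ∃ X ∉ Set.range o, ∀ i, X ∈ sec i (g i) := by
  obtain ⟨X, hX, ha, hb, hd⟩ := hE
  have hef := h.mem_of_ext hA hn hX ha hb hd
  obtain ⟨g1, g2, g3, g4, g5, g6⟩ := hg
  refine ⟨X, hX, fun i => ?_⟩
  rcases forall_eq_of_nodup hn i with rfl | rfl | rfl | rfl | rfl | rfl
  · rwa [g1]
  · rwa [g2]
  · rwa [g3]
  · rwa [g4, h.symm]
  · rwa [g5]
  · rwa [g6, h.symm]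

/-- Let `X` be the intersection of `sec a b` and `sec c d`. If `X` were not on `sec e f`, it would
lie on the tangent at `e` and, by parity, on the one at `f`. But these tangents meet on `sec a b'`.
-/
theorem exists_interior (h : OvalLines A o sec) (hA : IsPlane 5 A) {a b c d e f b' : Fin 6}
    {g : Fin 6 → Fin 6} (hE : Ext o sec e f a b') (hn : [a, b, c, d, e, f].Nodup) (hb' : b ≠ b')
    (hg : g a = b ∧ g b = a ∧ g c = d ∧ g d = c ∧ g e = f ∧ g f = e) :
    ∃ X ∉ Set.range o, ∀ i, X ∈ sec i (g i) := by
  have hall := forall_eq_of_nodup hn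
  simp only [List.nodup_cons, List.mem_cons, List.not_mem_nil, or_false, not_or] at hn
  obtain ⟨X, hX, hab, hcd⟩ := h.meet hA (a := a) (b := b) (c := c) (d := d) (by tauto) (by tauto)
    (by tauto) (by tauto)
  have hba := h.symm a b ▸ hab
  have hdc := h.symm c d ▸ hcd
  have hef : X ∈ sec e f := by
    obtain ⟨i, hi⟩ := h.exists_sec hX e
    have hi' := h.symm e i ▸ hi
    rcases hall i with rfl | rfl | rfl | rfl | rfl | rfl
    · exact absurd (h.unique hX hab hi') (by tauto)
    · exact absurd (h.unique hX hba hi') (by tauto)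
    · exact absurd (h.unique hX hcd hi') (by tauto)
    · exact absurd (h.unique hX hdc hi') (by tauto)
    · obtain ⟨j, hji, hj⟩ := h.exists_tangent_ne_of_even (by decide) hX hi
      have hjf : j = f := by
        rcases hall j with rfl | rfl | rfl | rfl | rfl | rfl
        · exact absurd (h.unique hX hab hj) (by tauto)
        · exact absurd (h.unique hX hba hj) (by tauto)
        · exact absurd (h.unique hX hcd hj) (by tauto)
        · exact absurd (h.unique hX hdc hj) (by tauto)
        · exact absurd rfl hji
        · rfl
      subst hjf
      exact absurd (h.ext_unique hA (by tauto) ⟨X, hX, hi, hj, hab⟩ hE) hb'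
    · exact hi
  obtain ⟨g1, g2, g3, g4, g5, g6⟩ := hg
  refine ⟨X, hX, fun i => ?_⟩
  rcases hall i with rfl | rfl | rfl | rfl | rfl | rfl
  · rwa [g1]
  · rwa [g2]
  · rwa [g3]
  · rwa [g4]
  · rwa [g5]
  · rwa [g6, h.symm]

end OvalLines

/-- The involutions that the points off an oval induce on it, in the plane of order 5. -/
def involutionsFive : Fin (5 ^ 2) → Fin (5 + 1) → Fin (5 + 1) :=
  ![![0, 1, 3, 2, 5, 4], ![0, 4, 2, 5, 1, 3], ![0, 5, 4, 3, 2, 1], ![0, 3, 5, 1, 4, 2], ![0, 2, 1,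
  4, 3, 5], ![5, 1, 2, 4, 3, 0], ![4, 1, 5, 3, 0, 2], ![2, 1, 0, 5, 4, 3], ![3, 1, 4, 0, 2, 5],
  ![1, 0, 2, 3, 5, 4], ![3, 5, 2, 0, 4, 1], ![4, 3, 2, 1, 0, 5], ![5, 2, 1, 3, 4, 0], ![2, 4, 0,
  3, 1, 5], ![1, 0, 3, 2, 4, 5], ![1, 0, 4, 5, 2, 3], ![1, 0, 5, 4, 3, 2], ![2, 3, 0, 1, 5, 4],
  ![2, 5, 0, 4, 3, 1], ![3, 2, 1, 0, 5, 4], ![3, 4, 5, 0, 1, 2], ![4, 2, 1, 5, 0, 3], ![4, 5, 3,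
  2, 0, 1], ![5, 3, 4, 1, 2, 0], ![5, 4, 3, 2, 1, 0]]

/-- The secants and tangents of the oval. -/
def secantsFive : List ℕ :=
  [1985, 7372803, 25698309, 100745225, 402788369, 1610876961, 30786, 168035334, 545391114,
  1141375122, 285278498, 231556, 1343225932, 538984724, 71307812, 823560, 20974616, 136323240,
  1384976, 41975920, 1721376]

/-- The lines that do not meet the oval, each with two of its points. -/
def externalsFive : List (ℕ × ℕ × ℕ) :=
  [(6, 17, 86376512), (8, 11, 210766080), (7, 14, 281297024), (9, 11, 304613888), (7, 12,
  588255360), (6, 16, 675872832), (10, 13, 872457216), (10, 12, 1084298240), (8, 13, 1111630080),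
  (9, 14, 1224786432)]

theorem exists_of_involutionsFive {P : Type*} {A : Set (Set P)} {o : Fin 6 → P}
    {sec : Fin 6 → Fin 6 → Set P} (h : OvalLines A o sec) (hA : IsPlane 5 A)
    (h1 : OvalLines.Ext o sec 0 1 2 3) (h2 : OvalLines.Ext o sec 0 2 1 4) (z : Fin (5 ^ 2)) :
    ∃ X ∉ Set.range o, ∀ i, X ∈ sec i (involutionsFive z i) := by
  obtain ⟨h3, h4, h5⟩ := h.ext_five hA h1 h2
  obtain ⟨h45, h23⟩ := h.ext_all hA (e := 4) (f := 5) (by decide) h1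
  obtain ⟨h35, h14⟩ := h.ext_all hA (e := 3) (f := 5) (by decide) h2
  obtain ⟨h24, h15⟩ := h.ext_all hA (e := 2) (f := 4) (by decide) h3
  obtain ⟨h25, h13⟩ := h.ext_all hA (e := 2) (f := 5) (by decide) h4
  obtain ⟨h34, h12⟩ := h.ext_all hA (e := 3) (f := 4) (by decide) h5
  -- The first fifteen involutions fix two points and come from the three tangent pairs of each of
  -- the five partitions; the last ten have no fixed points and are the remaining partitions.
  fin_cases z
  · exact h.exists_exterior hA (e := 4) (f := 5) h1 (by decide) (by decide)
  · exact h.exists_exterior hA (e := 3) (f := 5) h2 (by decide) (by decide)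
  · exact h.exists_exterior hA (e := 2) (f := 4) h3 (by decide) (by decide)
  · exact h.exists_exterior hA (e := 2) (f := 5) h4 (by decide) (by decide)
  · exact h.exists_exterior hA (e := 3) (f := 4) h5 (by decide) (by decide)
  · exact h.exists_exterior hA (e := 3) (f := 4) h12 (by decide) (by decide)
  · exact h.exists_exterior hA (e := 2) (f := 5) h13 (by decide) (by decide)
  · exact h.exists_exterior hA (e := 3) (f := 5) h14 (by decide) (by decide)
  · exact h.exists_exterior hA (e := 2) (f := 4) h15 (by decide) (by decide)
  · exact h.exists_exterior hA (e := 4) (f := 5) h23 (by decide) (by decide)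
  · exact h.exists_exterior hA (e := 1) (f := 5) h24 (by decide) (by decide)
  · exact h.exists_exterior hA (e := 1) (f := 3) h25 (by decide) (by decide)
  · exact h.exists_exterior hA (e := 1) (f := 2) h34 (by decide) (by decide)
  · exact h.exists_exterior hA (e := 1) (f := 4) h35 (by decide) (by decide)
  · exact h.exists_exterior hA (e := 2) (f := 3) h45 (by decide) (by decide)
  · exact h.exists_interior hA (b := 1) (c := 2) (d := 4) h35 (by decide) (by decide) (by decide)
  · exact h.exists_interior hA (b := 1) (c := 2) (d := 5) h34 (by decide) (by decide) (by decide)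
  · exact h.exists_interior hA (b := 2) (c := 1) (d := 3) h45 (by decide) (by decide) (by decide)
  · exact h.exists_interior hA (b := 2) (c := 1) (d := 5) h34 (by decide) (by decide) (by decide)
  · exact h.exists_interior hA (b := 3) (c := 1) (d := 2) h45 (by decide) (by decide) (by decide)
  · exact h.exists_interior hA (b := 3) (c := 1) (d := 4) h25 (by decide) (by decide) (by decide)
  · exact h.exists_interior hA (b := 4) (c := 1) (d := 2) h35 (by decide) (by decide) (by decide)
  · exact h.exists_interior hA (b := 4) (c := 1) (d := 5) h23 (by decide) (by decide) (by decide)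
  · exact h.exists_interior hA (b := 5) (c := 1) (d := 3) h24 (by decide) (by decide) (by decide)
  · exact h.exists_interior hA (b := 5) (c := 1) (d := 4) h23 (by decide) (by decide) (by decide)

/-- No three projective planes of order five are mutually orthogoval. -/
theorem false_of_order_five {P : Type*} [Finite P] {A B C : Set (Set P)} (hA : IsPlane 5 A)
    (hB : IsPlane 5 B) (hC : IsPlane 5 C) (hAB : AreOrthogoval A B) (hAC : AreOrthogoval A C)
    (hBC : AreOrthogoval B C) : False := by
  obtain ⟨o, sec, ho, ⟨b, hb, hob⟩, h⟩ := exists_oval (by norm_num) hA hB hAB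
  obtain ⟨π, h1, h2⟩ := h.exists_relabel hA
  exact false_of_involutions hA hB hC hAB hAC hBC (o := fun a => o (π a))
    (ho.comp π.injective) ⟨b, hb, fun a => hob (π a)⟩ (h.relabel π) (T := involutionsFive)
    (by decide +kernel) (exists_of_involutionsFive (h.relabel π) hA h1 h2)
    (known := secantsFive) (ext := externalsFive)
    -- As in order four, every line of `B` meets the oval, so pencils at the oval points complete
    -- `B`, and the search for `C` fails at the line joining 0 and 1.
    (ys := [6, 7, 8, 9, 10, 11, 12, 13, 14, 15, 16, 17, 18, 19, 20, 21, 22, 23, 24, 25, 26, 27, 28,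
      29, 30]) (as := [0, 1, 2, 3, 4, 5]) (ys' := [1]) (as' := [0]) (by decide +kernel)
    (by decide +kernel) (by decide +kernel) (by decide) (by decide) (by decide) (by decide)
    (by decide +kernel)

/-! ### Order three: pencils at one point -/

/-- The off-diagonal cells of a square of side four. -/
def cells : Fin 12 → Fin 4 × Fin 4 :=
  ![(0, 1), (0, 2), (0, 3), (1, 0), (1, 2), (1, 3), (2, 0), (2, 1), (2, 3), (3, 0), (3, 1), (3, 2)]

/-- The rows and columns of the square, together with a further point `12`. -/
def rowsAndColumns : List ℕ :=
  ((List.finRange 4).map fun i =>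
    Nat.ofBits (Fin.append (fun z => decide ((cells z).1 = i)) fun _ : Fin 1 => true)) ++
  (List.finRange 4).map fun j =>
    Nat.ofBits (Fin.append (fun z => decide ((cells z).2 = j)) fun _ : Fin 1 => true)

/-- Adds to each member of a list of pencils at the point `12` a further pencil that is orthogoval
to all of them. -/
noncomputable def nextPencils (cs : List ℕ) (Bs : List (List ℕ)) : List (List ℕ) :=
  recFoldr (fun B acc => cover 12 [11, 10, 9, 8, 7, 6, 5, 4, 3, 2, 1, 0]
    (recFilter (fun c => recAll (meetsTwo c) B) cs) B 0 acc) [] Bs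

theorem someIn_nextPencils {M Q : Set ℕ} (hM : LineMasks 13 4 M) {cs : List ℕ}
    (hcs : ∀ m ∈ M, m.testBit 12 → m ∈ cs) (hMQ : ∀ m ∈ M, ∀ b ∈ Q, MeetAtMostTwo m b)
    {Bs : List (List ℕ)} (h : SomeIn Q Bs) : SomeIn (Q ∪ M) (nextPencils cs Bs) := by
  obtain ⟨B, hB, hBQ⟩ := h
  refine someIn_recFoldr (fun B acc hacc => someIn_cover_of_someIn _ _ _ _ hacc) hB fun acc => ?_
  refine someIn_cover (M := M) Set.subset_union_right _ _ B _ acc ?_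
    (fun c hc d hd _ _ hcd => hM.meet hc hd hcd) (fun m hm => Or.inl (hBQ m hm)) ?_
  · intro y hy
    have : ∀ y ∈ [11, 10, 9, 8, 7, 6, 5, 4, 3, 2, 1, 0], y < 13 := by decide
    exact hM.join (by norm_num) (this y hy)
  · intro m hm hm12 _
    left
    rw [mem_recFilter]
    exact ⟨hcs m hm hm12, recAll_of_forall fun b hb => meetsTwo_of (hMQ m hm b (hBQ b hb))⟩

/-- The eight masks are `rowsAndColumns`. A candidate is the point 12 with three cells, no two in a
row or column. The twelve cells cannot be partitioned into such triples in three ways so that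
triples of different partitions share at most one cell. -/
theorem nextPencils_eq_nil :
    let cs := candidates 13 [] [4103, 4152, 4544, 7680, 4680, 5249, 6162, 4388] 4 12 0
    nextPencils cs (nextPencils cs (nextPencils cs [[]])) = [] := by
  decide +kernel

theorem IsPlane.exists_pencil {P : Type*} {q : ℕ} {A : Set (Set P)} (hA : IsPlane q A)
    (p : P) : ∃ α : Fin (q + 1) → Set P, α.Injective ∧ ∀ i, α i ∈ A ∧ p ∈ α i := by
  have hcard : Nat.card {ℓ | ℓ ∈ A ∧ p ∈ ℓ} = q + 1 := by
    rw [Nat.card_coe_set_eq, hA.ncard_pencil]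
  have : Finite {ℓ | ℓ ∈ A ∧ p ∈ ℓ} := Nat.finite_of_card_ne_zero (by omega)
  let e := (Finite.equivFinOfCardEq hcard).symm
  exact ⟨fun i => e i, Subtype.val_injective.comp e.injective, fun i => (e i).2⟩

/-- The pencils of two orthogoval planes at a point, arranged in such a way that corresponding lines
are tangent to each other. -/
theorem exists_pencils {P : Type*} [Finite P] {q : ℕ} (hq : 0 < q) {A B : Set (Set P)}
    (hA : IsPlane q A) (hB : IsPlane q B) (hAB : AreOrthogoval A B) (p : P) :
    ∃ α β : Fin (q + 1) → Set P, α.Injective ∧ β.Injective ∧ (∀ i, α i ∈ A ∧ p ∈ α i) ∧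
      (∀ i, β i ∈ B ∧ p ∈ β i) ∧ ∀ i j, i ≠ j → ∃ x, x ≠ p ∧ x ∈ α i ∧ x ∈ β j := by
  obtain ⟨α, hα, hαA⟩ := hA.exists_pencil p
  -- In `B`, the line `β i` is the tangent at `p` to the oval `α i`. Tangency is symmetric, so `α i`
  -- is the tangent to `β i` in `A`; hence `β` is injective. By uniqueness of tangents `β j` with `j
  -- ≠ i` meets `α i` again.
  choose β hβ using fun i => hB.exists_tangent (hA.ncard_line (hαA i).1) (hαA i).2
  have hβinj : β.Injective := by
    intro i j hij
    refine hα (hA.tangent_unique hq (hAB.isArc (hβ i).1) (hB.ncard_line (hβ i).1) (hβ i).2.1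
      (hαA i).1 (hαA i).2 (fun y hy hyα => (hβ i).2.2 y hyα hy) (hαA j).1 (hαA j).2
      fun y hy hyα => (hβ j).2.2 y hyα (hij ▸ hy))
  refine ⟨α, β, hα, hβinj, hαA, fun i => ⟨(hβ i).1, (hβ i).2.1⟩, fun i j hij => ?_⟩
  by_contra! hcon
  refine hij (hβinj (hB.tangent_unique hq (hAB.symm.isArc (hαA i).1) (hA.ncard_line (hαA i).1)
    (hαA i).2 (hβ i).1 (hβ i).2.1 (hβ i).2.2 (hβ j).1 (hβ j).2.1 fun y hy hyβ => ?_))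
  by_contra hyp
  exact hcon y hyp hy hyβ

/-- No five projective planes of order three are mutually orthogoval. -/
theorem false_of_order_three {P : Type*} [Finite P] {L : Fin 5 → Set (Set P)}
    (hL : ∀ i, IsPlane 3 (L i)) (horth : ∀ i j, i ≠ j → AreOrthogoval (L i) (L j)) : False := by
  have : Nonempty P := by
    have : 0 < Nat.card P := by rw [(hL 0).card_points]; omega
    exact (Nat.card_pos_iff.1 this).1
  obtain ⟨p⟩ := this
  obtain ⟨α, β, hα, hβ, hαA, hβB, hαβ⟩ :=
    exists_pencils (by norm_num) (hL 0) (hL 1) (horth 0 1 (by decide)) p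
  choose x hxp hxα hxβ using fun z : Fin 12 => hαβ (cells z).1 (cells z).2 (by revert z; decide)
  have hcells : cells.Injective := by decide
  -- The label of a cell (i, j) is a common point of `α i` and `β j` other than `p`; the point `p`
  -- gets the label 12.
  let lab : Fin (12 + 1) → P := Fin.append x fun _ => p
  have hinj : lab.Injective := by
    refine Fin.append_injective_iff.2 ⟨fun z w hzw => hcells (Prod.ext ?_ ?_), ?_, ?_⟩
    · exact hα ((hL 0).eq_of_mem (hαA _).1 (hαA _).1 (hxp z) (hxα z) (hαA _).2 (hzw ▸ hxα w)
        (hαA _).2)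
    · exact hβ ((hL 1).eq_of_mem (hβB _).1 (hβB _).1 (hxp z) (hxβ z) (hβB _).2 (hzw ▸ hxβ w)
        (hβB _).2)
    · exact fun a b _ => Subsingleton.elim a b
    · exact fun z _ => hxp z
  have hlab : lab.Bijective := hinj.bijective_of_nat_card_le (by
    rw [(hL 0).card_points, Nat.card_eq_fintype_card, Fintype.card_fin]
    norm_num)
  have hK : ∀ ℓ ∈ [4103, 4152, 4544, 7680, 4680, 5249, 6162, 4388],
      (∃ l ∈ L 0, ∀ i (h : i < 12 + 1), ℓ.testBit i → lab ⟨i, h⟩ ∈ l) ∨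
      ∃ l ∈ L 1, ∀ i (h : i < 12 + 1), ℓ.testBit i → lab ⟨i, h⟩ ∈ l := by
    have : [4103, 4152, 4544, 7680, 4680, 5249, 6162, 4388] = rowsAndColumns := by decide +kernel
    rw [this]
    intro ℓ hℓ
    rcases List.mem_append.1 hℓ with hℓ | hℓ
    · obtain ⟨a, -, rfl⟩ := List.mem_map.1 hℓ
      refine Or.inl ⟨α a, (hαA a).1, fun i hi hbit => ?_⟩
      rw [Nat.testBit_ofBits_lt _ _ hi] at hbit
      generalize (⟨i, hi⟩ : Fin (12 + 1)) = j at hbit ⊢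
      induction j using Fin.addCases with
      | left z =>
        rw [Fin.append_left, decide_eq_true_eq] at hbit
        simp only [lab, Fin.append_left, ← hbit]
        exact hxα z
      | right z =>
        simp only [lab, Fin.append_right]
        exact (hαA a).2
    · obtain ⟨a, -, rfl⟩ := List.mem_map.1 hℓ
      refine Or.inr ⟨β a, (hβB a).1, fun i hi hbit => ?_⟩
      rw [Nat.testBit_ofBits_lt _ _ hi] at hbit
      generalize (⟨i, hi⟩ : Fin (12 + 1)) = j at hbit ⊢
      induction j using Fin.addCases with
      | left z =>
        rw [Fin.append_left, decide_eq_true_eq] at hbit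
        simp only [lab, Fin.append_left, ← hbit]
        exact hxβ z
      | right z =>
        simp only [lab, Fin.append_right]
        exact (hβB a).2
  have hcs : ∀ i, i ≠ 0 → i ≠ 1 → ∀ m ∈ mask lab '' L i, m.testBit 12 →
      m ∈ candidates 13 [] [4103, 4152, 4544, 7680, 4680, 5249, 6162, 4388] 4 12 0 := by
    intro i h0 h1 m hm hm12
    have hM := (hL i).lineMasks hlab
    refine mem_candidates (hM.lt hm) (hM.count hm) hm12 (by simp) (fun ℓ hℓ => ?_) (by simp)
    rcases hK ℓ hℓ with h | h
    · exact (horth 0 i h0.symm).meetAtMostTwo hinj h hm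
    · exact (horth 1 i h1.symm).meetAtMostTwo hinj h hm
  have hmeet : ∀ i j, i ≠ j → ∀ m ∈ mask lab '' L i, ∀ b ∈ mask lab '' L j, MeetAtMostTwo m b :=
    fun i j hij m hm b hb => (horth i j hij).meetAtMostTwo hinj (exists_of_mem_image_mask hm) hb
  have s0 : SomeIn ∅ [[]] := ⟨[], by simp, by simp⟩
  have s1 := someIn_nextPencils ((hL 2).lineMasks hlab) (hcs 2 (by decide) (by decide))
    (by simp) s0
  have s2 := someIn_nextPencils ((hL 3).lineMasks hlab) (hcs 3 (by decide) (by decide))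
    (fun m hm b hb => by
      rcases hb with hb | hb
      · exact absurd hb (by simp)
      · exact hmeet 3 2 (by decide) m hm b hb) s1
  have s3 := someIn_nextPencils ((hL 4).lineMasks hlab) (hcs 4 (by decide) (by decide))
    (fun m hm b hb => by
      rcases hb with (hb | hb) | hb
      · exact absurd hb (by simp)
      · exact hmeet 4 2 (by decide) m hm b hb
      · exact hmeet 4 3 (by decide) m hm b hb) s2
  rw [nextPencils_eq_nil] at s3
  obtain ⟨B, hB, -⟩ := s3
  simp at hB

/-! ### Planes from difference sets -/

section Configuration

variable {P Q Λ : Type*} [Membership Q Λ]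

/-- Passes from an abstract type of lines to lines as sets of points. The order is unchanged because
q² + q + 1 determines q. -/
theorem isProjectivePlaneOfOrder_range [Finite Q] [Finite Λ] [Configuration.ProjectivePlane Q Λ]
    (e : Q ≃ P) : IsProjectivePlaneOfOrder (Configuration.ProjectivePlane.order Q Λ)
      (Set.range fun l : Λ => e '' {x | x ∈ l}) := by
  have hmem : ∀ (y : P) (l : Λ), y ∈ e '' {x | x ∈ l} ↔ e.symm y ∈ l := by
    intro y l
    rw [e.image_eq_preimage_symm]
    rfl
  choose g hg using fun ℓ : (Set.range fun l : Λ => e '' {x | x ∈ l}) => ℓ.2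
  have hmem' : ∀ (y : P) (ℓ : (Set.range fun l : Λ => e '' {x | x ∈ l})),
      y ∈ ℓ ↔ e.symm y ∈ g ℓ := by
    intro y ℓ
    rw [← hmem]
    change y ∈ ℓ.1 ↔ _
    rw [← hg ℓ]
  have hginj : ∀ ℓ m, g ℓ = g m → ℓ = m := by
    intro ℓ m h
    apply Subtype.ext
    rw [← hg ℓ, ← hg m, h]
  have hmk : ∀ (y : P) (l : Λ),
      y ∈ (⟨_, ⟨l, rfl⟩⟩ : (Set.range fun l : Λ => e '' {x | x ∈ l})) ↔ e.symm y ∈ l := hmem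
  let inst : Configuration.ProjectivePlane P (Set.range fun l : Λ => e '' {x | x ∈ l}) :=
    { exists_point := fun ℓ => by
        obtain ⟨x, hx⟩ := Configuration.Nondegenerate.exists_point (P := Q) (g ℓ)
        exact ⟨e x, by rwa [hmem', e.symm_apply_apply]⟩
      exists_line := fun y => by
        obtain ⟨l, hl⟩ := Configuration.Nondegenerate.exists_line (L := Λ) (e.symm y)
        exact ⟨⟨_, ⟨l, rfl⟩⟩, by rwa [hmk]⟩
      eq_or_eq := fun {y₁ y₂ l₁ l₂} h₁ h₂ h₃ h₄ => by
        rw [hmem'] at h₁ h₂ h₃ h₄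
        exact (Configuration.Nondegenerate.eq_or_eq h₁ h₂ h₃ h₄).imp (fun h => e.symm.injective h)
          (hginj _ _)
      mkPoint := fun {l₁ l₂} h =>
        e (Configuration.HasPoints.mkPoint (P := Q) fun h' => h (hginj l₁ l₂ h'))
      mkPoint_ax := fun {l₁ l₂} h => by
        rw [hmem', hmem', e.symm_apply_apply]
        exact Configuration.HasPoints.mkPoint_ax _
      mkLine := fun {x y} h => ⟨_, ⟨Configuration.HasLines.mkLine (L := Λ) (e.symm.injective.ne h),
        rfl⟩⟩
      mkLine_ax := fun {x y} h => by
        rw [hmk, hmk]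
        exact Configuration.HasLines.mkLine_ax _
      exists_config := by
        obtain ⟨p₁, p₂, p₃, l₁, l₂, l₃, h⟩ :=
          Configuration.ProjectivePlane.exists_config (P := Q) (L := Λ)
        refine ⟨e p₁, e p₂, e p₃, ⟨_, ⟨l₁, rfl⟩⟩, ⟨_, ⟨l₂, rfl⟩⟩, ⟨_, ⟨l₃, rfl⟩⟩, ?_⟩
        simpa only [hmk, e.symm_apply_apply] using h }
  refine ⟨inst, ?_⟩
  have : Finite P := Finite.of_equiv Q e
  have := Fintype.ofFinite P
  have := Fintype.ofFinite Q
  have h1 := Configuration.ProjectivePlane.card_points P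
    (Set.range fun l : Λ => e '' {x | x ∈ l})
  have h2 := Configuration.ProjectivePlane.card_points Q Λ
  rw [← Fintype.card_congr e, h2] at h1
  nlinarith

end Configuration

/-! ### Cyclic coordinates for PG(2, F) -/

section PG

variable {F : Type*} [Field F] [Finite F]

theorem card_pgPoint : Nat.card (PGPoint F) = Nat.card F ^ 2 + Nat.card F + 1 := by
  rw [Projectivization.card_of_finrank F (Fin 3 → F) (n := 3) (by simp), Finset.sum_range_succ,
    Finset.sum_range_succ, Finset.sum_range_one]
  ring

theorem IsCopyOfPG.isProjectivePlaneOfOrder {𝓛 : Set (Set (PGPoint F))} (h : IsCopyOfPG 𝓛) :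
    IsProjectivePlaneOfOrder (Nat.card F) 𝓛 := by
  classical
  obtain ⟨e, rfl⟩ := h
  have h := isProjectivePlaneOfOrder_range (Q := PGPoint F) (Λ := PGPoint F) e
  have hord : Configuration.ProjectivePlane.order (PGPoint F) (PGPoint F) = Nat.card F := by
    have := Fintype.ofFinite (PGPoint F)
    have h1 := Configuration.ProjectivePlane.card_points (PGPoint F) (PGPoint F)
    rw [← Nat.card_eq_fintype_card, card_pgPoint] at h1
    nlinarith
  rw [hord] at h
  convert h using 1
  rw [mapPlane, pgLines, ← Set.range_comp]
  rfl

/-- A cyclic description of `PG(2, F)` by a difference set, from coordinate vectors of the points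
and lines. -/
theorem exists_equiv_of_vectors {n : ℕ} [NeZero n] (hn : Nat.card F ^ 2 + Nat.card F + 1 = n)
    {D : Set (ZMod n)} (hD : ∀ x, (∀ i, i ∈ D ↔ i + x ∈ D) → x = 0) {r w : ZMod n → Fin 3 → F}
    (hr : ∀ i, r i ≠ 0) (hw : ∀ i, w i ≠ 0) (h : ∀ i j, r i ⬝ᵥ w j = 0 ↔ i - j ∈ D) :
    ∃ e : ZMod n ≃ PGPoint F, mapPlane e (development D) = pgLines F := by
  let f : ZMod n → PGPoint F := fun i => Projectivization.mk F (r i) (hr i)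
  let g : ZMod n → PGPoint F := fun i => Projectivization.mk F (w i) (hw i)
  have hfg : ∀ i j, (f i).orthogonal (g j) ↔ i - j ∈ D := fun i j =>
    (Projectivization.orthogonal_mk (hr i) (hw j)).trans (h i j)
  have hcard : Nat.card (PGPoint F) ≤ Nat.card (ZMod n) := by
    rw [card_pgPoint, hn, Nat.card_zmod]
  have hf : f.Bijective := by
    refine Function.Injective.bijective_of_nat_card_le (fun i j hij => ?_) hcard
    -- If two indices give the same point, `D` is invariant under translation by their difference,
    -- which is then zero by `hD`. The lines are treated in the same way below.
    have := hD (j - i) fun t => by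
      have h1 := hfg i (i - t)
      have h2 := hfg j (i - t)
      rw [hij] at h1
      rw [show i - (i - t) = t by ring] at h1
      rw [show j - (i - t) = t + (j - i) by ring] at h2
      exact h1.symm.trans h2
    exact (sub_eq_zero.1 this).symm
  have hg : g.Bijective := by
    refine Function.Injective.bijective_of_nat_card_le (fun i j hij => ?_) hcard
    have := hD (i - j) fun t => by
      have h1 := hfg (t + i) i
      have h2 := hfg (t + i) j
      rw [hij] at h1
      rw [show t + i - i = t by ring] at h1
      rw [show t + i - j = t + (i - j) by ring] at h2
      exact h1.symm.trans h2
    exact sub_eq_zero.1 this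
  refine ⟨Equiv.ofBijective f hf, ?_⟩
  rw [mapPlane, development, pgLines, ← Set.range_comp, ← hg.2.range_comp]
  congr 1
  funext j
  ext v
  obtain ⟨i, rfl⟩ := hf.2 v
  simp only [Function.comp_apply, Set.mem_ofPred_eq, hfg]
  constructor
  · rintro ⟨_, ⟨d, hd, rfl⟩, hdi⟩
    have : d + j = i := hf.1 hdi
    rw [← this, add_sub_cancel_right]
    exact hd
  · intro hij
    exact ⟨i, ⟨i - j, hij, by simp⟩, rfl⟩

/-- `exists_equiv_of_vectors` with coordinates in a ring that embeds into `F`. -/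
theorem exists_equiv_of_ringHom {K : Type*} [CommRing K] {φ : K →+* F} (hφ : Function.Injective φ)
    {n : ℕ} [NeZero n] (hn : Nat.card F ^ 2 + Nat.card F + 1 = n) {D : Set (ZMod n)}
    (hD : ∀ x, (∀ i, i ∈ D ↔ i + x ∈ D) → x = 0) {r w : ZMod n → Fin 3 → K}
    (hr : ∀ i, r i 0 ≠ 0 ∨ r i 1 ≠ 0 ∨ r i 2 ≠ 0) (hw : ∀ i, w i 0 ≠ 0 ∨ w i 1 ≠ 0 ∨ w i 2 ≠ 0)
    (h : ∀ i j, r i 0 * w j 0 + r i 1 * w j 1 + r i 2 * w j 2 = 0 ↔ i - j ∈ D) :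
    ∃ e : ZMod n ≃ PGPoint F, mapPlane e (development D) = pgLines F := by
  have hne : ∀ v : Fin 3 → K, (v 0 ≠ 0 ∨ v 1 ≠ 0 ∨ v 2 ≠ 0) → (fun a => φ (v a)) ≠ 0 := by
    intro v hv hv0
    have : ∀ a, v a = 0 := fun a => (map_eq_zero_iff φ hφ).1 (congrFun hv0 a)
    simp [this] at hv
  refine exists_equiv_of_vectors hn hD (r := fun i a => φ (r i a)) (w := fun i a => φ (w i a))
    (fun i => hne _ (hr i)) (fun i => hne _ (hw i)) fun i j => ?_
  rw [← h i j, ← map_eq_zero_iff φ hφ, dotProduct, Fin.sum_univ_three]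
  simp only [map_add, map_mul]

end PG

/-! ### Multiples of a difference set -/

section Multiples

theorem AreOrthogoval.mapPlane {P Q : Type*} {L M : Set (Set P)} (h : AreOrthogoval L M)
    (e : P ≃ Q) : AreOrthogoval (mapPlane e L) (mapPlane e M) := by
  rintro _ ⟨ℓ, hℓ, rfl⟩ _ ⟨m, hm, rfl⟩
  rw [← Set.image_inter e.injective, e.injective.encard_image]
  exact h ℓ hℓ m hm

/-- A line has at least three points, so a plane is not orthogoval to itself. This makes the planes
constructed below distinct. -/
theorem AreOrthogoval.ne {P : Type*} [Finite P] {q : ℕ} (hq : 1 < q) {L M : Set (Set P)}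
    (hL : IsProjectivePlaneOfOrder q L) (h : AreOrthogoval L M) : L ≠ M := by
  rintro rfl
  have hL := hL.isPlane
  have hpos : 0 < Nat.card P := by rw [hL.card_points]; omega
  obtain ⟨⟨x⟩, -⟩ := Nat.card_pos_iff.1 hpos
  obtain ⟨ℓ, hℓ, -⟩ := hL.join x x
  have h1 := h ℓ hℓ ℓ hℓ
  have h2 := hL.ncard_line hℓ
  rw [Set.inter_self, ← (Set.toFinite ℓ).cast_ncard_eq, h2] at h1
  have : q + 1 ≤ 2 := by exact_mod_cast h1
  omega

variable {F : Type*} [Field F] {n : ℕ}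

/-- Multiplication by a unit is a permutation of `ZMod n` that maps `D + x` to `c D + c x`. -/
theorem mapPlane_development_mul {D : Set (ZMod n)} {e : ZMod n ≃ PGPoint F}
    (he : mapPlane e (development D) = pgLines F) {c : ZMod n} (hc : IsUnit c) :
    IsCopyOfPG (mapPlane e (development ((fun d => c * d) '' D))) := by
  obtain ⟨u, rfl⟩ := hc
  refine ⟨e.symm.trans (u.mulLeft.trans e), ?_⟩
  rw [← he, mapPlane, mapPlane, mapPlane, development, development, ← Set.range_comp,
    ← Set.range_comp, ← Set.range_comp, ← u.mulLeft.surjective.range_comp]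
  congr 1
  funext x
  simp only [Function.comp_apply, Set.image_image, Units.mulLeft_apply, Equiv.trans_apply,
    Equiv.symm_apply_apply, mul_add]

theorem isMutuallyOrthogoval_multiples [Finite F] {D : Set (ZMod n)} {e : ZMod n ≃ PGPoint F}
    (he : mapPlane e (development D) = pgLines F) {C : Set (ZMod n)} (hC : ∀ c ∈ C, IsUnit c)
    (horth : ∀ c ∈ C, ∀ d ∈ C, c ≠ d → AreOrthogoval (development ((fun x => c * x) '' D))
      (development ((fun x => d * x) '' D))) :
    IsMutuallyOrthogoval (Nat.card F)
      ((fun c => mapPlane e (development ((fun x => c * x) '' D))) '' C) ∧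
    ((fun c => mapPlane e (development ((fun x => c * x) '' D))) '' C).ncard = C.ncard ∧
    ∀ 𝓛 ∈ (fun c => mapPlane e (development ((fun x => c * x) '' D))) '' C, IsCopyOfPG 𝓛 := by
  have hcopy : ∀ 𝓛 ∈ (fun c => mapPlane e (development ((fun x => c * x) '' D))) '' C,
      IsCopyOfPG 𝓛 := by
    rintro _ ⟨c, hc, rfl⟩
    exact mapPlane_development_mul he (hC c hc)
  refine ⟨⟨fun 𝓛 h𝓛 => (hcopy 𝓛 h𝓛).isProjectivePlaneOfOrder, ?_⟩, ?_, hcopy⟩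
  · rintro _ ⟨c, hc, rfl⟩ _ ⟨d, hd, rfl⟩ hne
    exact (horth c hc d hd fun h => hne (h ▸ rfl)).mapPlane e
  · refine Set.InjOn.ncard_image fun c hc d hd hcd => ?_
    by_contra hne
    exact ((horth c hc d hd hne).mapPlane e).ne Finite.one_lt_card
      (mapPlane_development_mul he (hC c hc)).isProjectivePlaneOfOrder hcd

/-- After a common translation only the difference of the two shifts matters, which leaves a finite
check. -/
theorem areOrthogoval_development {D E : Finset (ZMod n)}
    (h : ∀ x, (D ∩ E.image fun b => b + x).card ≤ 2) :
    AreOrthogoval (development (D : Set (ZMod n))) (development (E : Set (ZMod n))) := by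
  rintro _ ⟨x, rfl⟩ _ ⟨y, rfl⟩
  have : (fun b => b + x) '' (D : Set (ZMod n)) ∩ (fun b => b + y) '' (E : Set (ZMod n)) =
      (fun b => b + x) '' ((D ∩ E.image fun b => b + (y - x) : Finset (ZMod n)) : Set (ZMod n)) := by
    rw [Finset.coe_inter, Finset.coe_image, Set.image_inter (add_left_injective x),
      Set.image_image]
    congr 2
    funext b
    ring
  simp only [this, (add_left_injective x).encard_image, Set.encard_coe_eq_coe_finsetCard]
  exact_mod_cast h (y - x)

end Multiples

/-! ### The Singer difference sets of orders two to five -/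

section Singer

variable {F : Type*} [Field F] [Finite F]

theorem exists_ringHom_zmod {p : ℕ} (hp : p.Prime) (hF : Nat.card F = p) :
    ∃ φ : ZMod p →+* F, Function.Injective φ := by
  have : Fact p.Prime := ⟨hp⟩
  have := Fintype.ofFinite F
  have := charP_of_card_eq_prime (R := F) (p := p) (by rw [← hF, Nat.card_eq_fintype_card])
  exact ⟨ZMod.castHom dvd_rfl F, (ZMod.castHom dvd_rfl F).injective⟩

/-- A model of the field with four elements. -/
abbrev FourField : Type := QuadraticAlgebra (ZMod 2) 1 1

instance : Fact (∀ r : ZMod 2, r ^ 2 ≠ 1 + 1 * r) := ⟨by decide⟩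

theorem exists_ringHom_fourField (hF : Nat.card F = 4) :
    ∃ φ : FourField →+* F, Function.Injective φ := by
  have := Fintype.ofFinite F
  rw [Nat.card_eq_fintype_card] at hF
  have := charP_of_card_eq_prime_pow (R := F) (p := 2) (f := 2) (by rw [hF]; norm_num)
  let _ : Algebra (ZMod 2) F := ZMod.algebra F 2
  classical
  obtain ⟨u, -, hu⟩ : ∃ u ∈ (Finset.univ : Finset F), u ∉ ({0, 1} : Finset F) :=
    Finset.exists_mem_notMem_of_card_lt_card (by
      rw [Finset.card_univ, hF]
      exact (Finset.card_le_two).trans_lt (by norm_num))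
  simp only [Finset.mem_insert, Finset.mem_singleton, not_or] at hu
  have h3 : u ^ 3 = 1 := by
    have := FiniteField.pow_card_sub_one_eq_one u hu.1
    rwa [hF] at this
  have h0 : (u - 1) * (u * u + u + 1) = 0 := by linear_combination h3
  have h1 := (mul_eq_zero.1 h0).resolve_left (sub_ne_zero.2 hu.2)
  have h2 : (2 : F) = 0 := CharTwo.two_eq_zero
  -- An element `u` other than 0 and 1 is a primitive cube root of unity; in characteristic two u² +
  -- u + 1 = 0 reads u² = 1 + u, the relation that defines `FourField`.
  let φ : FourField →+* F := (QuadraticAlgebra.lift (R := ZMod 2) (a := 1) (b := 1) ⟨u, by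
    rw [one_smul, one_smul]
    linear_combination h1 - (u + 1) * h2⟩).toRingHom
  exact ⟨φ, φ.injective⟩

/-- Up to scalars, the vectors `r i` are the iterates of a Singer cycle applied to `r 0`, here (a,
b, c) ↦ (b, c, a + b), and `w j` is the line containing the points `r i` with `i - j ∈ D`. Orders
three, four and five follow the same pattern. -/
theorem exists_equiv_of_card_two (hF : Nat.card F = 2) : ∃ e : ZMod 7 ≃ PGPoint F,
    mapPlane e (development (({0, 1, 3} : Finset (ZMod 7)) : Set (ZMod 7))) = pgLines F := by
  obtain ⟨φ, hφ⟩ := exists_ringHom_zmod (by norm_num) hF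
  exact exists_equiv_of_ringHom hφ (by rw [hF]; norm_num) (by decide +kernel)
    (r := ![![0, 0, 1], ![0, 1, 0], ![1, 0, 1], ![0, 1, 1], ![1, 1, 1], ![1, 1, 0], ![1, 0, 0]])
    (w := ![![1, 0, 0], ![1, 0, 1], ![1, 1, 1], ![0, 1, 1], ![1, 1, 0], ![0, 0, 1], ![0, 1, 0]])
    (by decide +kernel) (by decide +kernel) (by decide +kernel)

theorem exists_equiv_of_card_three (hF : Nat.card F = 3) : ∃ e : ZMod 13 ≃ PGPoint F,
    mapPlane e (development (({0, 1, 3, 9} : Finset (ZMod 13)) : Set (ZMod 13))) = pgLines F := by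
  obtain ⟨φ, hφ⟩ := exists_ringHom_zmod (by norm_num) hF
  exact exists_equiv_of_ringHom hφ (by rw [hF]; norm_num) (by decide +kernel)
    (r := ![![0, 0, 1], ![0, 1, 0], ![1, 0, 1], ![0, 1, 1], ![1, 1, 1], ![1, 1, 2], ![1, 2, 2], ![1,
      1, 0], ![1, 0, 2], ![0, 1, 2], ![1, 2, 1], ![1, 2, 0], ![1, 0, 0]])
    (w := ![![1, 0, 0], ![1, 0, 2], ![1, 1, 2], ![0, 1, 2], ![1, 2, 0], ![1, 0, 1], ![1, 2, 2], ![1,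
      2, 1], ![1, 1, 1], ![0, 1, 1], ![1, 1, 0], ![0, 0, 1], ![0, 1, 0]])
    (by decide +kernel) (by decide +kernel) (by decide +kernel)

theorem exists_equiv_of_card_four (hF : Nat.card F = 4) : ∃ e : ZMod 21 ≃ PGPoint F,
    mapPlane e (development (({0, 1, 4, 14, 16} : Finset (ZMod 21)) : Set (ZMod 21))) =
      pgLines F := by
  obtain ⟨φ, hφ⟩ := exists_ringHom_fourField hF
  exact exists_equiv_of_ringHom hφ (by rw [hF]; norm_num) (by decide +kernel)
    (r := ![![⟨0, 0⟩, ⟨0, 0⟩, ⟨1, 0⟩], ![⟨0, 0⟩, ⟨1, 0⟩, ⟨1, 0⟩], ![⟨1, 0⟩, ⟨1, 0⟩, ⟨0, 0⟩], ![⟨1, 0⟩,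
      ⟨0, 0⟩, ⟨1, 1⟩], ![⟨0, 0⟩, ⟨1, 0⟩, ⟨0, 1⟩], ![⟨1, 0⟩, ⟨0, 1⟩, ⟨1, 1⟩], ![⟨1, 0⟩, ⟨0, 1⟩, ⟨0,
      1⟩], ![⟨1, 0⟩, ⟨1, 0⟩, ⟨1, 0⟩], ![⟨1, 0⟩, ⟨1, 0⟩, ⟨0, 1⟩], ![⟨1, 0⟩, ⟨0, 1⟩, ⟨1, 0⟩], ![⟨1,
      0⟩, ⟨1, 1⟩, ⟨1, 1⟩], ![⟨1, 0⟩, ⟨1, 0⟩, ⟨1, 1⟩], ![⟨1, 0⟩, ⟨1, 1⟩, ⟨0, 0⟩], ![⟨1, 0⟩, ⟨0, 0⟩,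
      ⟨0, 1⟩], ![⟨0, 0⟩, ⟨1, 0⟩, ⟨0, 0⟩], ![⟨1, 0⟩, ⟨0, 0⟩, ⟨1, 0⟩], ![⟨0, 0⟩, ⟨1, 0⟩, ⟨1, 1⟩],
      ![⟨1, 0⟩, ⟨1, 1⟩, ⟨0, 1⟩], ![⟨1, 0⟩, ⟨1, 1⟩, ⟨1, 0⟩], ![⟨1, 0⟩, ⟨0, 1⟩, ⟨0, 0⟩], ![⟨1, 0⟩,
      ⟨0, 0⟩, ⟨0, 0⟩]])
    (w := ![![⟨1, 0⟩, ⟨0, 0⟩, ⟨0, 0⟩], ![⟨1, 0⟩, ⟨1, 0⟩, ⟨1, 0⟩], ![⟨1, 0⟩, ⟨1, 0⟩, ⟨0, 1⟩], ![⟨1, 0⟩,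
      ⟨1, 1⟩, ⟨0, 1⟩], ![⟨0, 0⟩, ⟨1, 0⟩, ⟨1, 1⟩], ![⟨1, 0⟩, ⟨1, 1⟩, ⟨0, 0⟩], ![⟨0, 0⟩, ⟨1, 0⟩, ⟨1,
      0⟩], ![⟨1, 0⟩, ⟨1, 0⟩, ⟨0, 0⟩], ![⟨1, 0⟩, ⟨0, 1⟩, ⟨0, 1⟩], ![⟨1, 0⟩, ⟨1, 0⟩, ⟨1, 1⟩], ![⟨1,
      0⟩, ⟨0, 0⟩, ⟨0, 1⟩], ![⟨1, 0⟩, ⟨0, 1⟩, ⟨1, 0⟩], ![⟨1, 0⟩, ⟨0, 1⟩, ⟨1, 1⟩], ![⟨1, 0⟩, ⟨0, 0⟩,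
      ⟨1, 1⟩], ![⟨1, 0⟩, ⟨0, 0⟩, ⟨1, 0⟩], ![⟨1, 0⟩, ⟨1, 1⟩, ⟨1, 0⟩], ![⟨0, 0⟩, ⟨1, 0⟩, ⟨0, 1⟩],
      ![⟨1, 0⟩, ⟨0, 1⟩, ⟨0, 0⟩], ![⟨1, 0⟩, ⟨1, 1⟩, ⟨1, 1⟩], ![⟨0, 0⟩, ⟨0, 0⟩, ⟨1, 0⟩], ![⟨0, 0⟩,
      ⟨1, 0⟩, ⟨0, 0⟩]])
    (by decide +kernel) (by decide +kernel) (by decide +kernel)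

theorem exists_equiv_of_card_five (hF : Nat.card F = 5) : ∃ e : ZMod 31 ≃ PGPoint F,
    mapPlane e (development (({0, 1, 3, 8, 12, 18} : Finset (ZMod 31)) : Set (ZMod 31))) =
      pgLines F := by
  obtain ⟨φ, hφ⟩ := exists_ringHom_zmod (by norm_num) hF
  exact exists_equiv_of_ringHom hφ (by rw [hF]; norm_num) (by decide +kernel)
    (r := ![![0, 0, 1], ![0, 1, 0], ![1, 0, 4], ![0, 1, 4], ![1, 4, 4], ![1, 1, 3], ![1, 3, 0], ![1,
      0, 1], ![0, 1, 1], ![1, 1, 4], ![1, 4, 0], ![1, 0, 3], ![0, 1, 2], ![1, 2, 4], ![1, 2, 2],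
      ![1, 1, 2], ![1, 2, 0], ![1, 0, 2], ![0, 1, 3], ![1, 3, 4], ![1, 3, 1], ![1, 2, 1], ![1, 3,
      2], ![1, 4, 1], ![1, 4, 3], ![1, 2, 3], ![1, 4, 2], ![1, 3, 3], ![1, 1, 1], ![1, 1, 0], ![1,
      0, 0]])
    (w := ![![1, 0, 0], ![1, 0, 1], ![1, 1, 1], ![1, 3, 3], ![1, 2, 4], ![1, 3, 2], ![1, 3, 4], ![1,
      1, 4], ![1, 2, 3], ![1, 1, 2], ![1, 1, 3], ![1, 4, 3], ![0, 1, 2], ![1, 2, 0], ![1, 0, 2],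
      ![1, 2, 1], ![1, 2, 2], ![1, 4, 2], ![0, 1, 3], ![1, 3, 0], ![1, 0, 4], ![1, 4, 1], ![0, 1,
      1], ![1, 1, 0], ![1, 0, 3], ![1, 3, 1], ![1, 4, 4], ![0, 1, 4], ![1, 4, 0], ![0, 0, 1], ![0,
      1, 0]])
    (by decide +kernel) (by decide +kernel) (by decide +kernel)

/-! ### The extremal sizes -/

theorem two_mem_sizes {n : ℕ} {D : Finset (ZMod n)} {e : ZMod n ≃ PGPoint F}
    (he : mapPlane e (development (D : Set (ZMod n))) = pgLines F)
    (h : ∀ x, (D ∩ (D.image fun b => -1 * b).image fun b => b + x).card ≤ 2)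
    (hn : (1 : ZMod n) ≠ -1) : 2 ∈ desarguesianOrthogovalSizes F := by
  have h1 := areOrthogoval_development h
  rw [Finset.coe_image] at h1
  have h2 := isMutuallyOrthogoval_multiples he (C := {1, -1}) (by
    rintro c (rfl | rfl)
    · exact isUnit_one
    · exact isUnit_one.neg) (by
    have hone : (fun x : ZMod n => 1 * x) '' (D : Set (ZMod n)) = D := by simp
    rintro c (rfl | rfl) d (rfl | rfl) hcd
    · exact absurd rfl hcd
    · rw [hone]; exact h1
    · rw [hone]; exact h1.symm
    · exact absurd rfl hcd)
  exact ⟨_, h2.1, h2.2.2, h2.2.1.trans (Set.ncard_pair hn)⟩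

theorem isGreatest_two {q : ℕ} (hF : Nat.card F = q) (h2 : 2 ∈ desarguesianOrthogovalSizes F)
    (h : ∀ A B C : Set (Set (PGPoint F)), IsPlane q A → IsPlane q B → IsPlane q C →
      AreOrthogoval A B → AreOrthogoval A C → AreOrthogoval B C → False) :
    IsGreatest (orthogovalSizes F) 2 ∧ IsGreatest (desarguesianOrthogovalSizes F) 2 := by
  have hsub : desarguesianOrthogovalSizes F ⊆ orthogovalSizes F :=
    fun n ⟨S, hS, _, hn⟩ => ⟨S, hS, hn⟩
  have hub : 2 ∈ upperBounds (orthogovalSizes F) := by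
    rintro n ⟨S, hS, rfl⟩
    by_contra! hlt
    obtain ⟨A, hA, B, hB, C, hC, hAB, hAC, hBC⟩ := (Set.two_lt_ncard (Set.toFinite S)).1 hlt
    have hp : ∀ L ∈ S, IsPlane q L := fun L hL => hF ▸ (hS.isProjectivePlane L hL).isPlane
    exact h A B C (hp A hA) (hp B hB) (hp C hC) (hS.pairwise hA hB hAB) (hS.pairwise hA hC hAC)
      (hS.pairwise hB hC hBC)
  exact ⟨⟨hsub h2, hub⟩, h2, fun n hn => hub (hsub hn)⟩

theorem four_mem_upperBounds (hF : Nat.card F = 3) : 4 ∈ upperBounds (orthogovalSizes F) := by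
  rintro n ⟨S, hS, rfl⟩
  by_contra! hlt
  obtain ⟨T, hTS, hT⟩ := Set.exists_subset_card_eq (n := 5) hlt
  let e : Fin 5 ≃ T := (Finite.equivFinOfCardEq ((Nat.card_coe_set_eq T).trans hT)).symm
  refine false_of_order_three (L := fun i => (e i : Set (Set (PGPoint F)))) (fun i => ?_) fun i j hij => ?_
  · exact hF ▸ (hS.isProjectivePlane _ (hTS (e i).2)).isPlane
  · exact hS.pairwise (hTS (e i).2) (hTS (e j).2) fun h => hij (e.injective (Subtype.ext h))

/-- A single bijection serves all four developments: only that of `D` needs coordinates, the others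
being multiples of it by units. -/
theorem cyclicPlanes_of_card_three (hF : Nat.card F = 3) : ∃ e : ZMod 13 ≃ PGPoint F,
    mapPlane e (development (multipleD 1)) = pgLines F ∧
    IsMutuallyOrthogoval 3 (mapPlane e '' cyclicPlanes) ∧
    (mapPlane e '' cyclicPlanes).ncard = 4 ∧ ∀ 𝓛 ∈ mapPlane e '' cyclicPlanes, IsCopyOfPG 𝓛 := by
  obtain ⟨e, he⟩ := exists_equiv_of_card_three hF
  have hcoe : (({0, 1, 3, 9} : Finset (ZMod 13)) : Set (ZMod 13)) = {0, 1, 3, 9} := by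
    push_cast; rfl
  have horth : ∀ c ∈ ({1, -1, 2, -2} : Finset (ZMod 13)), ∀ d ∈ ({1, -1, 2, -2} : Finset (ZMod 13)),
      c ≠ d → ∀ x, ((({0, 1, 3, 9} : Finset (ZMod 13)).image fun b => c * b) ∩
        (({0, 1, 3, 9} : Finset (ZMod 13)).image fun b => d * b).image fun b => b + x).card ≤ 2 := by
    decide +kernel
  have hunit : ∀ c ∈ ({1, -1, 2, -2} : Finset (ZMod 13)), ∃ d, c * d = 1 := by decide +kernel
  have h := isMutuallyOrthogoval_multiples he
    (C := (({1, -1, 2, -2} : Finset (ZMod 13)) : Set (ZMod 13)))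
    (fun c hc => by
      obtain ⟨d, hd⟩ := hunit c hc
      exact IsUnit.of_mul_eq_one d hd)
    (fun c hc d hd hcd => by
      have := areOrthogoval_development (horth c hc d hd hcd)
      rwa [Finset.coe_image, Finset.coe_image] at this)
  have himage : (fun c => mapPlane e (development ((fun x => c * x) ''
      (({0, 1, 3, 9} : Finset (ZMod 13)) : Set (ZMod 13))))) ''
      (({1, -1, 2, -2} : Finset (ZMod 13)) : Set (ZMod 13)) = mapPlane e '' cyclicPlanes := by
    simp only [cyclicPlanes, multipleD, Finset.coe_insert, Finset.coe_singleton, Set.image_insert_eq,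
      Set.image_singleton]
  rw [himage, hF, Set.ncard_coe_finset] at h
  refine ⟨e, ?_, h.1, h.2.1, h.2.2⟩
  rw [← he, multipleD, hcoe]
  simp

end Singer

end Orthogoval

theorem theorem2p3 (F : Type*) [Field F] [Finite F] :
    ((Nat.card F = 2 ∨ Nat.card F = 4 ∨ Nat.card F = 5) →
      IsGreatest (Orthogoval.orthogovalSizes F) 2 ∧
      IsGreatest (Orthogoval.desarguesianOrthogovalSizes F) 2) ∧
    (Nat.card F = 3 →
      IsGreatest (Orthogoval.orthogovalSizes F) 4 ∧
      IsGreatest (Orthogoval.desarguesianOrthogovalSizes F) 4 ∧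
      ∃ e : ZMod 13 ≃ Orthogoval.PGPoint F,
        Orthogoval.mapPlane e (Orthogoval.development (Orthogoval.multipleD 1)) =
          Orthogoval.pgLines F ∧
        Orthogoval.IsMutuallyOrthogoval 3 (Orthogoval.mapPlane e '' Orthogoval.cyclicPlanes) ∧
        (Orthogoval.mapPlane e '' Orthogoval.cyclicPlanes).ncard = 4) := by
  open Orthogoval in
  refine ⟨?_, fun hF => ?_⟩
  · rintro (hF | hF | hF)
    · obtain ⟨e, he⟩ := exists_equiv_of_card_two hF
      exact isGreatest_two hF (two_mem_sizes he (by decide +kernel) (by decide))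
        fun A B C hA hB hC => false_of_order_two hA hB hC
    · obtain ⟨e, he⟩ := exists_equiv_of_card_four hF
      exact isGreatest_two hF (two_mem_sizes he (by decide +kernel) (by decide))
        fun A B C hA hB hC => false_of_order_four hA hB hC
    · obtain ⟨e, he⟩ := exists_equiv_of_card_five hF
      exact isGreatest_two hF (two_mem_sizes he (by decide +kernel) (by decide))
        fun A B C hA hB hC => false_of_order_five hA hB hC
  · obtain ⟨e, he, h1, h2, h3⟩ := cyclicPlanes_of_card_three hF
    have hub := four_mem_upperBounds hF
    rw [← hF] at h1
    refine ⟨⟨⟨_, h1, h2⟩, hub⟩, ⟨⟨_, h1, h3, h2⟩, ?_⟩, e, he, hF ▸ h1, h2⟩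
    rintro n ⟨S, hS, -, hn⟩
    exact hub ⟨S, hS, hn⟩
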